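/- Let $\mathbb X=[X_1\rightrightarrows X_0]$ be a Lie groupoid with source and target maps $s,t$, where $s$ is a submersion (manifolds are smooth, finite dimensional, without boundary, not necessarily Hausdorff). A \emph{connection} on $\mathbb X$ is a smooth distribution $\mathcal H\subset TX_1$ with $\mathcal H\oplus\ker ds=TX_1$, with $\mathcal H_{e(x)}=de(T_xX_0)$ for every unit $e(x)$, and such that the maps $\theta_\gamma:T_{s(\gamma)}X_0\cong\mathcal H_\gamma\xrightarrow{dt}T_{t(\gamma)}X_0$ satisfy $\theta_{\gamma'\circ\gamma}=\theta_{\gamma'}\circ\theta_{\gamma}$ for composable arrows; it is \emph{integrable} if through each point of $X_1$ there passes an integral manifold of $\mathcal H$. For a form $\varphi$ on $X_1$ let $\widehat{\mathcal H}(\varphi)$ be the form obtained by precomposing all arguments with the projection $TX_1\to\mathcal H$ along $\ker ds$. A $k$-form $\varphi$ on $X_0$ with values in a vector space is a \emph{differential $k$-form on $(\mathbb X,\mathcal H)$} if $\widehat{\mathcal H}(s^*\varphi)=\widehat{\mathcal H}(t^*\varphi)$. Let $G$ be a Lie group with Lie algebra $\mathfrak g$, and let $\pi:E_G\to X_0$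 be a principal $G$-bundle over $\mathbb X$, i.e. a (right) principal $G$-bundle over $X_0$ with a smooth left action $\mu:s^*E_G\to E_G$, $(\gamma,a)\mapsto\gamma\cdot a$, of $\mathbb X$ along $\pi$ that commutes with $G$. For $w\in T_aE_G$ and $\gamma$ with $s(\gamma)=\pi(a)$ put $\widetilde\theta_{\gamma,a}(w)=d\mu_{(\gamma,a)}(v,w)$, where $v\in\mathcal H_\gamma$ is the vector with $ds(v)=d\pi(w)$. The maps $\theta$ and $\widetilde\theta$ define actions of $\mathbb X$ on $TX_0$ and on $\mathrm{At}(E_G)=TE_G/G$, and the latter restricts to an action on $\mathrm{ad}(E_G)=(E_G\times\mathfrak g)/G\cong\ker(d\pi)/G$. Let $\mathcal D:TX_0\to\mathrm{At}(E_G)$ be a connection on $(E_G\to X_0,\mathbb X)$, i.e. a smooth splitting of the Atiyah sequence $0\to\mathrm{ad}(E_G)\to\mathrm{At}(E_G)\to TX_0\to0$ that commutes with the actions of $\mathbb X$. Let $\omega\in\Omega^1(E_G,\mathfrak g)$ be its connection form, and let $[\omega,\omega](v_1,v_2)=[\omega(v_1),\omega(v_2)]$. The curvature $\mathcal K_{\mathcal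 D}$ is the $\mathrm{ad}(E_G)$-valued $2$-form on $X_0$ with $\pi^*\mathcal K_{\mathcal D}=d\omega+[\omega,\omega]$; that is, for $u,v\in T_xX_0$ and $a\in\pi^{-1}(x)$, $\mathcal K_{\mathcal D}(u,v)=[a,(d\omega+[\omega,\omega])_a(\tilde u,\tilde v)]\in \mathrm{ad}(E_G)_x$, where $\tilde u,\tilde v\in T_aE_G$ are the $\mathcal D$-horizontal lifts of $u,v$. Assume that $\mathcal H$ is integrable. Then $\mathcal K_{\mathcal D}$ is a differential $2$-form on the Lie groupoid $(\mathbb X,\mathcal H)$ with values in $\mathrm{ad}(E_G)$: the class $[a,(d\omega+[\omega,\omega])_a(\tilde u,\tilde v)]$ does not depend on the choice of $a\in\pi^{-1}(x)$, and for every arrow $\gamma\in X_1$ and all $v_1,v_2\in T_\gamma X_1$, $$\widehat{\mathcal H}(t^*\mathcal K_{\mathcal D})(\gamma)(v_1,v_2)=\gamma\cdot\bigl(\widehat{\mathcal H}(s^*\mathcal K_{\mathcal D})(\gamma)(v_1,v_2)\bigr),$$ where $\gamma\cdot:\mathrm{ad}(E_G)_{s(\gamma)}\to\mathrm{ad}(E_G)_{t(\gamma)}$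 is the action of $\mathbb X$ on $\mathrm{ad}(E_G)$. In particular, if a $\mathfrak g$-valued $2$-form $\mathcal K$ on $X_0$ satisfies $\pi^*\mathcal K=d\omega+[\omega,\omega]$, then $\widehat{\mathcal H}(s^*\mathcal K)=\widehat{\mathcal H}(t^*\mathcal K)$, that is, $\mathcal K$ is a $\mathfrak g$-valued differential $2$-form on $(\mathbb X,\mathcal H)$. -/

import Mathlib

open Set Function
open scoped Manifold ContDiff Topology

noncomputable section

/-! ### Tangent spaces, pullback of forms, exterior derivative of 1-forms

All manifolds are smooth, without boundary, finite dimensional, modelled on a normed space `E` with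
`𝓘(ℝ, E)`; they need not be Hausdorff. -/

/-- The tangent space `T_x M` of a manifold `M` modelled on `E`. -/
abbrev Tan (E : Type*) [NormedAddCommGroup E] [NormedSpace ℝ E]
    {M : Type*} [TopologicalSpace M] [ChartedSpace E M] (x : M) : Type _ :=
  TangentSpace 𝓘(ℝ, E) x

/-- The differential `df_x : T_x M → T_{f x} N`, as a linear map. -/
def tanMap (E F : Type*) [NormedAddCommGroup E] [NormedSpace ℝ E]
    [NormedAddCommGroup F] [NormedSpace ℝ F]
    {M N : Type*} [TopologicalSpace M] [ChartedSpace E M] [TopologicalSpace N] [ChartedSpace F N]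
    (f : M → N) (x : M) : Tan E x →ₗ[ℝ] Tan F (f x) :=
  (mfderiv 𝓘(ℝ, E) 𝓘(ℝ, F) f x).toLinearMap

/-- The identification of `T_x M` with `T_y M` when `x = y`. -/
def tanCast {E : Type*} [NormedAddCommGroup E] [NormedSpace ℝ E]
    {M : Type*} [TopologicalSpace M] [ChartedSpace E M] {x y : M} (h : x = y) :
    Tan E x →ₗ[ℝ] Tan E y :=
  h ▸ LinearMap.id

/-- A vector field `V` on `M` is smooth on the set `U`. -/
def SmoothFieldOn (E : Type*) [NormedAddCommGroup E] [NormedSpace ℝ E]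
    {M : Type*} [TopologicalSpace M] [ChartedSpace E M] [IsManifold 𝓘(ℝ, E) ∞ M]
    (V : ∀ x : M, Tan E x) (U : Set M) : Prop :=
  ContMDiffOn 𝓘(ℝ, E) 𝓘(ℝ, E).tangent ∞ (fun x => (⟨x, V x⟩ : TangentBundle 𝓘(ℝ, E) M)) U

/-- The pullback `f^* φ` of a `k`-form `φ` on `N` whose value at `y` lies in a vector space `W y`:
`(f^* φ)_x (v₁, …, v_k) = φ_{f x} (df v₁, …, df v_k)`. -/
def pullbackForm (E F : Type*) [NormedAddCommGroup E] [NormedSpace ℝ E]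
    [NormedAddCommGroup F] [NormedSpace ℝ F]
    {M N : Type*} [TopologicalSpace M] [ChartedSpace E M] [TopologicalSpace N] [ChartedSpace F N]
    {k : ℕ} {W : N → Type*} [∀ y, AddCommGroup (W y)] [∀ y, Module ℝ (W y)]
    (f : M → N) (φ : ∀ y : N, Tan F y [⋀^Fin k]→ₗ[ℝ] W y) (x : M) :
    Tan E x [⋀^Fin k]→ₗ[ℝ] W (f x) :=
  (φ (f x)).compLinearMap (tanMap E F f x)

/-- A 1-form `α` on `M` with values in a normed space `V`, read in the chart around `x₀`: the
pullback of `α` along the inverse of that chart. -/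
def chartOneForm {E V : Type*} [NormedAddCommGroup E] [NormedSpace ℝ E] [FiniteDimensional ℝ E]
    [NormedAddCommGroup V] [NormedSpace ℝ V]
    {M : Type*} [TopologicalSpace M] [ChartedSpace E M]
    (α : ∀ x : M, Tan E x →ₗ[ℝ] V) (x₀ : M) (y : E) : E →L[ℝ] V :=
  LinearMap.toContinuousLinearMap
    (α ((extChartAt 𝓘(ℝ, E) x₀).symm y) ∘ₗ
      tanMap E E (extChartAt 𝓘(ℝ, E) x₀).symm y ∘ₗ
      (NormedSpace.fromTangentSpace (𝕜 := ℝ) y).symm.toLinearEquiv.toLinearMap)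

/-- The exterior derivative `dα` of a 1-form `α` on a manifold, computed at each point `x` in the
chart around `x`, with the normalisation `dα(X, Y) = X(α(Y)) - Y(α(X)) - α([X, Y])`. -/
def extDerivOneForm {E V : Type*} [NormedAddCommGroup E] [NormedSpace ℝ E] [FiniteDimensional ℝ E]
    [NormedAddCommGroup V] [NormedSpace ℝ V]
    {M : Type*} [TopologicalSpace M] [ChartedSpace E M]
    (α : ∀ x : M, Tan E x →ₗ[ℝ] V) (x : M) : Tan E x [⋀^Fin 2]→ₗ[ℝ] V :=
  (extDeriv (fun y => ContinuousAlternatingMap.ofSubsingleton ℝ E V (0 : Fin 1)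
      (chartOneForm α x y)) (extChartAt 𝓘(ℝ, E) x x)).toAlternatingMap.compLinearMap
    ((NormedSpace.fromTangentSpace (𝕜 := ℝ) (extChartAt 𝓘(ℝ, E) x x)).toLinearEquiv.toLinearMap ∘ₗ
      tanMap E E (extChartAt 𝓘(ℝ, E) x) x)

/-- The bracket `[α, α]` of a Lie algebra valued linear form `α` with itself, normalised as
`½ ∑_{σ ∈ S₂} sgn(σ) [α(v_{σ 1}), α(v_{σ 2})] = [α(v₁), α(v₂)]`. -/
def bracketForm {V L : Type*} [AddCommGroup V] [Module ℝ V] [LieRing L] [LieAlgebra ℝ L]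
    (α : V →ₗ[ℝ] L) : V [⋀^Fin 2]→ₗ[ℝ] L where
  toFun v := ⁅α (v 0), α (v 1)⁆
  map_update_add' v i x y := by
    fin_cases i <;> simp [Function.update]
  map_update_smul' v i c x := by
    fin_cases i <;> simp [Function.update]
  map_eq_zero_of_eq' v i j h hij := by
    fin_cases i <;> fin_cases j <;> simp_all

/-! ### Distributions -/

/-- A smooth distribution: a field of subspaces that is locally spanned by a smooth frame. -/
def IsSmoothDistribution (E : Type*) [NormedAddCommGroup E] [NormedSpace ℝ E]
    {M : Type*} [TopologicalSpace M] [ChartedSpace E M] [IsManifold 𝓘(ℝ, E) ∞ M]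
    (H : ∀ x : M, Submodule ℝ (Tan E x)) : Prop :=
  ∀ x₀ : M, ∃ (U : Set M) (k : ℕ) (V : Fin k → ∀ x : M, Tan E x), IsOpen U ∧ x₀ ∈ U ∧
    (∀ i, SmoothFieldOn E (V i) U) ∧
    ∀ x ∈ U, LinearIndependent ℝ (fun i => V i x) ∧ Submodule.span ℝ (range fun i => V i x) = H x

/-- A distribution is integrable if through every point `x` there is an integral manifold: an
immersion `σ` of an open neighbourhood of `0` in some `ℝⁿ`, with `σ 0 = x`, whose tangent spaces
are the subspaces of the distribution. -/
def IsIntegrableDistribution (E : Type*) [NormedAddCommGroup E] [NormedSpace ℝ E]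
    {M : Type*} [TopologicalSpace M] [ChartedSpace E M]
    (H : ∀ x : M, Submodule ℝ (Tan E x)) : Prop :=
  ∀ x : M, ∃ (n : ℕ) (U : Set (EuclideanSpace ℝ (Fin n))) (σ : EuclideanSpace ℝ (Fin n) → M),
    IsOpen U ∧ 0 ∈ U ∧ σ 0 = x ∧
    ContMDiffOn 𝓘(ℝ, EuclideanSpace ℝ (Fin n)) 𝓘(ℝ, E) ∞ σ U ∧
    ∀ u ∈ U, Injective (tanMap (EuclideanSpace ℝ (Fin n)) E σ u) ∧
      LinearMap.range (tanMap (EuclideanSpace ℝ (Fin n)) E σ u) = H (σ u)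

/-! ### Lie groupoids and their connections -/

/-- A Lie groupoid `[X₁ ⇉ X₀]`. The composition `mul γ' γ` (first `γ`, then `γ'`) is meaningful for
`s γ' = t γ` only. The fibre product `{(γ', γ) | s γ' = t γ}` is an embedded submanifold of
`X₁ × X₁`, and a map on it is smooth iff it is `C^∞` along this subset. -/
structure LieGroupoid (E₀ E₁ : Type*) [NormedAddCommGroup E₀] [NormedSpace ℝ E₀]
    [NormedAddCommGroup E₁] [NormedSpace ℝ E₁]
    (X₀ X₁ : Type*) [TopologicalSpace X₀] [ChartedSpace E₀ X₀]
    [TopologicalSpace X₁] [ChartedSpace E₁ X₁] where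
  s : X₁ → X₀
  t : X₁ → X₀
  e : X₀ → X₁
  inv : X₁ → X₁
  mul : X₁ → X₁ → X₁
  smooth_s : ContMDiff 𝓘(ℝ, E₁) 𝓘(ℝ, E₀) ∞ s
  smooth_t : ContMDiff 𝓘(ℝ, E₁) 𝓘(ℝ, E₀) ∞ t
  smooth_e : ContMDiff 𝓘(ℝ, E₀) 𝓘(ℝ, E₁) ∞ e
  smooth_inv : ContMDiff 𝓘(ℝ, E₁) 𝓘(ℝ, E₁) ∞ inv
  smooth_mul : ContMDiffOn (𝓘(ℝ, E₁).prod 𝓘(ℝ, E₁)) 𝓘(ℝ, E₁) ∞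
    (fun p : X₁ × X₁ => mul p.1 p.2) {p | s p.1 = t p.2}
  submersion_s : ∀ γ, Surjective (tanMap E₁ E₀ s γ)
  s_e : ∀ x, s (e x) = x
  t_e : ∀ x, t (e x) = x
  s_inv : ∀ γ, s (inv γ) = t γ
  t_inv : ∀ γ, t (inv γ) = s γ
  s_mul : ∀ γ' γ, s γ' = t γ → s (mul γ' γ) = s γ
  t_mul : ∀ γ' γ, s γ' = t γ → t (mul γ' γ) = t γ'
  mul_assoc : ∀ γ'' γ' γ, s γ'' = t γ' → s γ' = t γ →
    mul (mul γ'' γ') γ = mul γ'' (mul γ' γ)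
  e_mul : ∀ γ, mul (e (t γ)) γ = γ
  mul_e : ∀ γ, mul γ (e (s γ)) = γ
  inv_mul : ∀ γ, mul (inv γ) γ = e (s γ)
  mul_inv : ∀ γ, mul γ (inv γ) = e (t γ)

namespace LieGroupoid

section

variable {E₀ E₁ : Type*} [NormedAddCommGroup E₀] [NormedSpace ℝ E₀]
  [NormedAddCommGroup E₁] [NormedSpace ℝ E₁]
  {X₀ X₁ : Type*} [TopologicalSpace X₀] [ChartedSpace E₀ X₀]
  [TopologicalSpace X₁] [ChartedSpace E₁ X₁]

/-- For a complement `H_γ` of `ker ds_γ`, the isomorphism `T_{s γ} X₀ ≅ H_γ` inverse to `ds_γ`,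
followed by the inclusion in `T_γ X₁`. -/
def horLift (𝕏 : LieGroupoid E₀ E₁ X₀ X₁) (H : ∀ γ : X₁, Submodule ℝ (Tan E₁ γ))
    (hH : ∀ γ, IsCompl (H γ) (LinearMap.ker (tanMap E₁ E₀ 𝕏.s γ))) (γ : X₁) :
    Tan E₀ (𝕏.s γ) →ₗ[ℝ] Tan E₁ γ :=
  (H γ).subtype ∘ₗ (LinearEquiv.ofBijective ((tanMap E₁ E₀ 𝕏.s γ).domRestrict (H γ)) (by
    constructor
    · rw [← LinearMap.ker_eq_bot, LinearMap.ker_eq_bot']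
      rintro ⟨v, hv⟩ h
      have h0 : v ∈ H γ ⊓ LinearMap.ker (tanMap E₁ E₀ 𝕏.s γ) := ⟨hv, h⟩
      rw [(hH γ).inf_eq_bot] at h0
      exact Subtype.ext h0
    · intro u
      obtain ⟨v, rfl⟩ := 𝕏.submersion_s γ u
      have hv : v ∈ H γ ⊔ LinearMap.ker (tanMap E₁ E₀ 𝕏.s γ) := by
        rw [(hH γ).sup_eq_top]; trivial
      obtain ⟨a, ha, b, hb, rfl⟩ := Submodule.mem_sup.1 hv
      refine ⟨⟨a, ha⟩, ?_⟩
      rw [map_add, LinearMap.mem_ker.1 hb, add_zero]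
      rfl)).symm.toLinearMap

/-- The map `θ_γ : T_{s γ} X₀ ≅ H_γ ⊂ T_γ X₁ → T_{t γ} X₀`, the last arrow being `dt`. -/
def theta (𝕏 : LieGroupoid E₀ E₁ X₀ X₁) (H : ∀ γ : X₁, Submodule ℝ (Tan E₁ γ))
    (hH : ∀ γ, IsCompl (H γ) (LinearMap.ker (tanMap E₁ E₀ 𝕏.s γ))) (γ : X₁) :
    Tan E₀ (𝕏.s γ) →ₗ[ℝ] Tan E₀ (𝕏.t γ) :=
  tanMap E₁ E₀ 𝕏.t γ ∘ₗ 𝕏.horLift H hH γ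

/-- A connection on a Lie groupoid: a distribution `H ⊂ TX₁` complementary to `ker ds`, containing
the tangent spaces of the units as `H_{e x} = de (T_x X₀)`, and such that
`θ_{γ' ∘ γ} = θ_{γ'} ∘ θ_γ` for all composable `γ', γ`. -/
structure Connection [IsManifold 𝓘(ℝ, E₁) ∞ X₁] (𝕏 : LieGroupoid E₀ E₁ X₀ X₁) where
  H : ∀ γ : X₁, Submodule ℝ (Tan E₁ γ)
  smooth_H : IsSmoothDistribution E₁ H
  isCompl : ∀ γ, IsCompl (H γ) (LinearMap.ker (tanMap E₁ E₀ 𝕏.s γ))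
  unit : ∀ x, LinearMap.range (tanMap E₀ E₁ 𝕏.e x) = H (𝕏.e x)
  theta_mul : ∀ (γ' γ : X₁) (h : 𝕏.s γ' = 𝕏.t γ) (u : Tan E₀ (𝕏.s γ)),
    tanCast (𝕏.t_mul γ' γ h)
        (𝕏.theta H isCompl (𝕏.mul γ' γ) (tanCast (𝕏.s_mul γ' γ h).symm u)) =
      𝕏.theta H isCompl γ' (tanCast h.symm (𝕏.theta H isCompl γ u))

namespace Connection

variable [IsManifold 𝓘(ℝ, E₁) ∞ X₁] {𝕏 : LieGroupoid E₀ E₁ X₀ X₁}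

/-- The connection is integrable (flat): the distribution `H ⊂ TX₁` is integrable. -/
def IsIntegrable (𝓗 : 𝕏.Connection) : Prop := IsIntegrableDistribution E₁ 𝓗.H

/-- The projection `P_{H_γ}` of `T_γ X₁ = H_γ ⊕ ker ds_γ` onto `H_γ`. -/
def proj (𝓗 : 𝕏.Connection) (γ : X₁) : Tan E₁ γ →ₗ[ℝ] Tan E₁ γ :=
  (𝓗.H γ).projection (LinearMap.ker (tanMap E₁ E₀ 𝕏.s γ)) (𝓗.isCompl γ)

/-- The horizontal component at `γ` of a form on `X₁`: precomposition with `P_{H_γ}` in all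
arguments. -/
def horPart (𝓗 : 𝕏.Connection) {k : ℕ} {W : Type*} [AddCommGroup W] [Module ℝ W] (γ : X₁)
    (φ : Tan E₁ γ [⋀^Fin k]→ₗ[ℝ] W) : Tan E₁ γ [⋀^Fin k]→ₗ[ℝ] W :=
  φ.compLinearMap (𝓗.proj γ)

/-- A `W`-valued `k`-form `φ` on `X₀` is a differential `k`-form on the Lie groupoid with
connection `𝓗` if the horizontal components of `s^* φ` and `t^* φ` agree. -/
def IsForm (𝓗 : 𝕏.Connection) {k : ℕ} {W : Type*} [AddCommGroup W] [Module ℝ W]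
    (φ : ∀ x : X₀, Tan E₀ x [⋀^Fin k]→ₗ[ℝ] W) : Prop :=
  ∀ γ : X₁, 𝓗.horPart γ (pullbackForm E₁ E₀ (W := fun _ => W) 𝕏.s φ γ) =
    𝓗.horPart γ (pullbackForm E₁ E₀ (W := fun _ => W) 𝕏.t φ γ)

end Connection

end

end LieGroupoid

/-! ### Principal bundles over a Lie groupoid -/

instance instLieGroupMinSmoothness {EG : Type*} [NormedAddCommGroup EG] [NormedSpace ℝ EG]
    {G : Type*} [TopologicalSpace G] [ChartedSpace EG G] [Group G] [LieGroup 𝓘(ℝ, EG) ∞ G] :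
    LieGroup 𝓘(ℝ, EG) (minSmoothness ℝ 3) G :=
  LieGroup.of_le (n := ∞) (by
    rw [minSmoothness_of_isRCLikeNormedField]
    exact WithTop.coe_le_coe.2 (le_top : (3 : ℕ∞) ≤ ⊤))

/-- The adjoint action `Ad_g : 𝔤 → 𝔤`, the differential at `1` of `h ↦ g h g⁻¹`. -/
def lieAd (EG : Type*) [NormedAddCommGroup EG] [NormedSpace ℝ EG]
    {G : Type*} [TopologicalSpace G] [ChartedSpace EG G] [Group G] (g : G) :
    GroupLieAlgebra 𝓘(ℝ, EG) G →ₗ[ℝ] GroupLieAlgebra 𝓘(ℝ, EG) G :=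
  tanCast (show g * 1 * g⁻¹ = 1 by simp) ∘ₗ tanMap EG EG (fun h : G => g * h * g⁻¹) 1

/-- The Lie algebra as a normed space: `𝔤` is the model space of `G` as a vector space, and the
identity is an isomorphism. -/
def lieModel (EG : Type*) [NormedAddCommGroup EG] [NormedSpace ℝ EG]
    (G : Type*) [TopologicalSpace G] [ChartedSpace EG G] [Group G] :
    GroupLieAlgebra 𝓘(ℝ, EG) G ≃ₗ[ℝ] EG :=
  LinearEquiv.refl ℝ EG

/-- A right principal `G`-bundle `π : P → X₀` over a Lie groupoid `[X₁ ⇉ X₀]`: a smooth, locally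
trivial principal `G`-bundle over `X₀` with a smooth left action `μ` of the groupoid on `P` along
`π`, commuting with the action of `G`. The element `μ γ p` is meaningful for `s γ = π p` only, and
the fibre product `s^*P = {(γ, p) | s γ = π p}` is an embedded submanifold of `X₁ × P`. -/
structure GroupoidBundle {E₀ E₁ : Type*} [NormedAddCommGroup E₀] [NormedSpace ℝ E₀]
    [NormedAddCommGroup E₁] [NormedSpace ℝ E₁]
    {X₀ X₁ : Type*} [TopologicalSpace X₀] [ChartedSpace E₀ X₀]
    [TopologicalSpace X₁] [ChartedSpace E₁ X₁] (𝕏 : LieGroupoid E₀ E₁ X₀ X₁)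
    (EP EG : Type*) [NormedAddCommGroup EP] [NormedSpace ℝ EP]
    [NormedAddCommGroup EG] [NormedSpace ℝ EG]
    (P G : Type*) [TopologicalSpace P] [ChartedSpace EP P]
    [TopologicalSpace G] [ChartedSpace EG G] [Group G] where
  π : P → X₀
  act : P → G → P
  smooth_π : ContMDiff 𝓘(ℝ, EP) 𝓘(ℝ, E₀) ∞ π
  smooth_act : ContMDiff (𝓘(ℝ, EP).prod 𝓘(ℝ, EG)) 𝓘(ℝ, EP) ∞ (fun q : P × G => act q.1 q.2)
  act_one : ∀ p, act p 1 = p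
  act_mul : ∀ p g h, act p (g * h) = act (act p g) h
  π_act : ∀ p g, π (act p g) = π p
  /-- Around every point of `X₀` there is a `G`-equivariant diffeomorphism `ψ : U × G → π⁻¹ U`
  over `U`, with inverse `p ↦ (π p, χ p)`. -/
  locally_trivial : ∀ x₀ : X₀, ∃ (U : Set X₀) (ψ : X₀ → G → P) (χ : P → G),
    IsOpen U ∧ x₀ ∈ U ∧
    ContMDiffOn (𝓘(ℝ, E₀).prod 𝓘(ℝ, EG)) 𝓘(ℝ, EP) ∞ (fun q : X₀ × G => ψ q.1 q.2) (U ×ˢ univ) ∧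
    ContMDiffOn 𝓘(ℝ, EP) 𝓘(ℝ, EG) ∞ χ (π ⁻¹' U) ∧
    (∀ x ∈ U, ∀ g, π (ψ x g) = x ∧ χ (ψ x g) = g) ∧
    (∀ p ∈ π ⁻¹' U, ψ (π p) (χ p) = p) ∧
    ∀ x ∈ U, ∀ g h, ψ x (g * h) = act (ψ x g) h
  μ : X₁ → P → P
  smooth_μ : ContMDiffOn (𝓘(ℝ, E₁).prod 𝓘(ℝ, EP)) 𝓘(ℝ, EP) ∞
    (fun q : X₁ × P => μ q.1 q.2) {q | 𝕏.s q.1 = π q.2}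
  π_μ : ∀ γ p, 𝕏.s γ = π p → π (μ γ p) = 𝕏.t γ
  e_μ : ∀ p, μ (𝕏.e (π p)) p = p
  mul_μ : ∀ γ' γ p, 𝕏.s γ' = 𝕏.t γ → 𝕏.s γ = π p → μ (𝕏.mul γ' γ) p = μ γ' (μ γ p)
  μ_act : ∀ γ p g, 𝕏.s γ = π p → act (μ γ p) g = μ γ (act p g)

namespace GroupoidBundle

section

variable {E₀ E₁ : Type*} [NormedAddCommGroup E₀] [NormedSpace ℝ E₀]
  [NormedAddCommGroup E₁] [NormedSpace ℝ E₁]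
  {X₀ X₁ : Type*} [TopologicalSpace X₀] [ChartedSpace E₀ X₀]
  [TopologicalSpace X₁] [ChartedSpace E₁ X₁] {𝕏 : LieGroupoid E₀ E₁ X₀ X₁}
  {EP EG : Type*} [NormedAddCommGroup EP] [NormedSpace ℝ EP]
  [NormedAddCommGroup EG] [NormedSpace ℝ EG]
  {P G : Type*} [TopologicalSpace P] [ChartedSpace EP P]
  [TopologicalSpace G] [ChartedSpace EG G] [Group G]

/-- The fibre `P_x = π⁻¹(x)`. -/
abbrev Fiber (B : GroupoidBundle 𝕏 EP EG P G) (x : X₀) : Type _ := {p : P // B.π p = x}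

/-- The action of `g ∈ G` on a fibre of `P`. -/
def fiberAct (B : GroupoidBundle 𝕏 EP EG P G) {x : X₀} (p : B.Fiber x) (g : G) : B.Fiber x :=
  ⟨B.act p.1 g, (B.π_act p.1 g).trans p.2⟩

/-- The action `P_{s γ} → P_{t γ}` of an arrow `γ`. -/
def fiberMove (B : GroupoidBundle 𝕏 EP EG P G) (γ : X₁) (p : B.Fiber (𝕏.s γ)) :
    B.Fiber (𝕏.t γ) :=
  ⟨B.μ γ p.1, B.π_μ γ p.1 p.2.symm⟩

/-- The differential of the projection at `p ∈ P_x`, as a map `T_p P → T_x X₀`. -/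
def dπ (B : GroupoidBundle 𝕏 EP EG P G) {x : X₀} (p : B.Fiber x) : Tan EP p.1 →ₗ[ℝ] Tan E₀ x :=
  tanCast p.2 ∘ₗ tanMap EP E₀ B.π p.1

/-- The infinitesimal action `𝔤 → T_p P`, the differential at `1` of `g ↦ p · g`. -/
def infAct (B : GroupoidBundle 𝕏 EP EG P G) (p : P) :
    GroupLieAlgebra 𝓘(ℝ, EG) G →ₗ[ℝ] Tan EP p :=
  tanCast (B.act_one p) ∘ₗ tanMap EG EP (fun g => B.act p g) 1

/-- The fibre at `x` of the Atiyah bundle `At(P) = TP / G`. The action of `G` on `P_x` being simply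
transitive, a `G`-orbit in the restriction of `TP` to `P_x` is the same as a `G`-invariant field
`ξ(p) ∈ T_p P`, `p ∈ P_x`, of tangent vectors along `P_x`. -/
def atFiber (B : GroupoidBundle 𝕏 EP EG P G) (x : X₀) :
    Submodule ℝ (∀ p : B.Fiber x, Tan EP p.1) where
  carrier := {ξ | ∀ (p : B.Fiber x) (g : G),
    ξ (B.fiberAct p g) = tanMap EP EP (fun q => B.act q g) p.1 (ξ p)}
  zero_mem' p g := (map_zero _).symm
  add_mem' {ξ η} hξ hη p g := by
    rw [Pi.add_apply, Pi.add_apply, hξ p g, hη p g]; exact (map_add _ _ _).symm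
  smul_mem' c ξ hξ p g := by
    rw [Pi.smul_apply, Pi.smul_apply, hξ p g]; exact (map_smul _ _ _).symm

/-- The fibre at `x` of the adjoint bundle `ad(P) = (P × 𝔤) / G`. A class `[p, A]`, with
`[p · g, Ad_{g⁻¹} A] = [p, A]`, is the same as a map `ξ : P_x → 𝔤` with `ξ(p) = A` and
`ξ(q · g) = Ad_{g⁻¹} ξ(q)`. -/
def adFiber (B : GroupoidBundle 𝕏 EP EG P G) (x : X₀) :
    Submodule ℝ (B.Fiber x → GroupLieAlgebra 𝓘(ℝ, EG) G) where
  carrier := {ξ | ∀ (p : B.Fiber x) (g : G), ξ (B.fiberAct p g) = lieAd EG g⁻¹ (ξ p)}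
  zero_mem' p g := (map_zero _).symm
  add_mem' {ξ η} hξ hη p g := by
    rw [Pi.add_apply, Pi.add_apply, hξ p g, hη p g]; exact (map_add _ _ _).symm
  smul_mem' c ξ hξ p g := by
    rw [Pi.smul_apply, Pi.smul_apply, hξ p g]; exact (map_smul _ _ _).symm

variable [IsManifold 𝓘(ℝ, E₁) ∞ X₁]

/-- The map `θ̃_{(γ, p)} : T_p P → T_{γ · p} P`, `w ↦ dμ_{(γ, p)} (v, w)`, of the groupoid
`[s^*P ⇉ P]` with the pullback connection; here `v ∈ H_γ` is the horizontal vector with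
`ds v = dπ w`. The pair `(v, w)` is tangent to the submanifold `s^*P` of `X₁ × P`, and on such
vectors the derivative of `μ` within `s^*P` is the differential of `μ : s^*P → P`. -/
def thetaTilde (B : GroupoidBundle 𝕏 EP EG P G) (𝓗 : 𝕏.Connection) (γ : X₁)
    (p : B.Fiber (𝕏.s γ)) (w : Tan EP p.1) : Tan EP (B.fiberMove γ p).1 :=
  mfderivWithin (𝓘(ℝ, E₁).prod 𝓘(ℝ, EP)) 𝓘(ℝ, EP) (fun q : X₁ × P => B.μ q.1 q.2)
    {q | 𝕏.s q.1 = B.π q.2} (γ, p.1)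
    ((𝕏.horLift 𝓗.H 𝓗.isCompl γ (B.dπ p w), w) : Tan E₁ γ × Tan EP p.1)

/-- The action of `𝕏` on `At(P)`: `ξ' = γ · ξ`, for `ξ ∈ At(P)_{s γ}` and `ξ' ∈ At(P)_{t γ}`. -/
def IsAtAct (B : GroupoidBundle 𝕏 EP EG P G) (𝓗 : 𝕏.Connection) (γ : X₁)
    (ξ : B.atFiber (𝕏.s γ)) (ξ' : B.atFiber (𝕏.t γ)) : Prop :=
  ∀ p : B.Fiber (𝕏.s γ), ξ'.1 (B.fiberMove γ p) = B.thetaTilde 𝓗 γ p (ξ.1 p)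

/-- The action of `𝕏` on `ad(P)`: `ξ' = γ · ξ`, for `ξ ∈ ad(P)_{s γ}` and `ξ' ∈ ad(P)_{t γ}`. It is
the restriction of the action on `At(P)` to the vertical vectors, which are identified with elements
of `𝔤` by the infinitesimal action. -/
def IsAdAct (B : GroupoidBundle 𝕏 EP EG P G) (𝓗 : 𝕏.Connection) (γ : X₁)
    (ξ : B.Fiber (𝕏.s γ) → GroupLieAlgebra 𝓘(ℝ, EG) G)
    (ξ' : B.Fiber (𝕏.t γ) → GroupLieAlgebra 𝓘(ℝ, EG) G) : Prop :=
  ∀ p : B.Fiber (𝕏.s γ), B.infAct (B.fiberMove γ p).1 (ξ' (B.fiberMove γ p)) =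
    B.thetaTilde 𝓗 γ p (B.infAct p.1 (ξ p))

/-- `φ` is an `ad(P)`-valued `k`-form on `X₀` and a differential `k`-form on the Lie groupoid with
connection `𝓗`: at every arrow `γ`, the action of `γ` takes the values of the horizontal component
of `s^* φ`, in `ad(P)_{s γ}`, to the values of the horizontal component of `t^* φ`, in
`ad(P)_{t γ}`. -/
def IsAdForm (B : GroupoidBundle 𝕏 EP EG P G) (𝓗 : 𝕏.Connection) {k : ℕ}
    (φ : ∀ x : X₀, Tan E₀ x [⋀^Fin k]→ₗ[ℝ] (B.Fiber x → GroupLieAlgebra 𝓘(ℝ, EG) G)) : Prop :=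
  (∀ x v, φ x v ∈ B.adFiber x) ∧
  ∀ (γ : X₁) (v : Fin k → Tan E₁ γ),
    B.IsAdAct 𝓗 γ
      (𝓗.horPart γ
        (pullbackForm E₁ E₀ (W := fun x => B.Fiber x → GroupLieAlgebra 𝓘(ℝ, EG) G) 𝕏.s φ γ) v)
      (𝓗.horPart γ
        (pullbackForm E₁ E₀ (W := fun x => B.Fiber x → GroupLieAlgebra 𝓘(ℝ, EG) G) 𝕏.t φ γ) v)

/-- A connection on the principal bundle over `(𝕏, 𝓗)`: a smooth splitting `D : TX₀ → At(P)` of the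
Atiyah sequence that commutes with the actions of `𝕏` on `TX₀` (by `θ`) and on `At(P)`. Smoothness
says that `D` takes smooth vector fields on open subsets `U` of `X₀` to smooth invariant vector
fields on `π⁻¹ U`. -/
structure Connection [IsManifold 𝓘(ℝ, E₀) ∞ X₀] [IsManifold 𝓘(ℝ, EP) ∞ P]
    (B : GroupoidBundle 𝕏 EP EG P G) (𝓗 : 𝕏.Connection) where
  D : ∀ x : X₀, Tan E₀ x →ₗ[ℝ] B.atFiber x
  splits : ∀ (x : X₀) (p : B.Fiber x) (v : Tan E₀ x), B.dπ p ((D x v).1 p) = v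
  smooth_D : ∀ (U : Set X₀) (V : ∀ x : X₀, Tan E₀ x), IsOpen U → SmoothFieldOn E₀ V U →
    SmoothFieldOn EP (fun p : P => (D (B.π p) (V (B.π p))).1 ⟨p, rfl⟩) (B.π ⁻¹' U)
  equivariant : ∀ (γ : X₁) (v : Tan E₀ (𝕏.s γ)),
    B.IsAtAct 𝓗 γ (D (𝕏.s γ) v) (D (𝕏.t γ) (𝕏.theta 𝓗.H 𝓗.isCompl γ v))

namespace Connection

variable [IsManifold 𝓘(ℝ, E₀) ∞ X₀] [IsManifold 𝓘(ℝ, EP) ∞ P]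
  {B : GroupoidBundle 𝕏 EP EG P G} {𝓗 : 𝕏.Connection}

/-- The horizontal lift `T_x X₀ → T_p P` at a point `p` over `x`. -/
def lift (D : B.Connection 𝓗) {x : X₀} (p : B.Fiber x) : Tan E₀ x →ₗ[ℝ] Tan EP p.1 :=
  LinearMap.proj p ∘ₗ (B.atFiber x).subtype ∘ₗ D.D x

/-- The connection form `ω` on `P`: `ω_p(w) ∈ 𝔤` is the element whose infinitesimal action at `p` is
the vertical component of `w`. -/
def form (D : B.Connection 𝓗) (p : P) : Tan EP p →ₗ[ℝ] GroupLieAlgebra 𝓘(ℝ, EG) G :=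
  (B.infAct p).leftInverse ∘ₗ
    (LinearMap.id - D.lift (x := B.π p) ⟨p, rfl⟩ ∘ₗ B.dπ (x := B.π p) ⟨p, rfl⟩)

variable [FiniteDimensional ℝ EP] [FiniteDimensional ℝ EG] [LieGroup 𝓘(ℝ, EG) ∞ G]

/-- The 2-form `dω + [ω, ω]` on `P`. -/
def maurerCartan (D : B.Connection 𝓗) (p : P) :
    Tan EP p [⋀^Fin 2]→ₗ[ℝ] GroupLieAlgebra 𝓘(ℝ, EG) G :=
  haveI : CompleteSpace EG := FiniteDimensional.complete ℝ EG
  (lieModel EG G).symm.toLinearMap.compAlternatingMap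
      (extDerivOneForm (fun q : P => (lieModel EG G).toLinearMap ∘ₗ D.form q) p) +
    bracketForm (D.form p)

/-- The curvature 2-form `K_D` on `X₀`, with values in `ad(P)`: for `u, v ∈ T_x X₀`, the class
`K_D(u, v) ∈ ad(P)_x` has at `p ∈ P_x` the value of `dω + [ω, ω]` on the horizontal lifts of `u`
and `v` to `p`. -/
def curvature (D : B.Connection 𝓗) (x : X₀) :
    Tan E₀ x [⋀^Fin 2]→ₗ[ℝ] (B.Fiber x → GroupLieAlgebra 𝓘(ℝ, EG) G) :=
  AlternatingMap.pi fun p : B.Fiber x => (D.maurerCartan p.1).compLinearMap (D.lift p)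

/-- A 2-form `K` on `X₀` with values in `ad(P)` and with `π^* K = dω + [ω, ω]` is the curvature. -/
theorem eq_curvature (D : B.Connection 𝓗)
    (K : ∀ x : X₀, Tan E₀ x [⋀^Fin 2]→ₗ[ℝ] (B.Fiber x → GroupLieAlgebra 𝓘(ℝ, EG) G))
    (hK : ∀ (x : X₀) (p : B.Fiber x) (w : Fin 2 → Tan EP p.1),
      K x (fun i => B.dπ p (w i)) p = D.maurerCartan p.1 w) (x : X₀) :
    K x = D.curvature x := by
  ext v p
  have h := hK x p (fun i => D.lift p (v i))
  have h2 : (fun i => B.dπ p (D.lift p (v i))) = v := funext fun i => D.splits x p (v i)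
  rw [h2] at h
  exact h

end Connection

end

end GroupoidBundle

end

/-! On horizontal vectors the bracket term of `dω + [ω, ω]` vanishes, so everything reduces to how
`dω` behaves on horizontal lifts. The exterior derivative is natural, hence it suffices to find
local maps `f` of `P` with `f^*ω = L ∘ ω` on an open set, for a fixed linear `L` on the Lie algebra.
An equality at a single point would say nothing about `dω`.

For independence of the point of the fibre, `f` is right translation by `g` and `L = Ad_{g⁻¹}`
(`liftedCurvature_act`). For an arrow `γ` integrability enters: the integral manifold of `H` through
`γ` is, near `γ`, the image of a section `S` of `s` with horizontal tangent vectors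
(`IsIntegrable.exists_section`). The map `q ↦ S(π q) · q` extends the action of `γ` to an open set
of `P`, and its differential at each point is `θ̃` for the arrow `S(π q)`. It carries horizontal
lifts to horizontal lifts because `D` is equivariant, and fundamental vectors to fundamental vectors
of the same Lie algebra element because `μ` commutes with `G`. So it preserves `ω`, now with `L =
id`, and therefore `dω` (`liftedCurvature_move`). Since `γ` acts on the adjoint bundle by `[p, A] ↦
[γ · p, A]` (`thetaTilde_infAct`), this is the claim.

The analytic input is naturality of the exterior derivative (`extDerivOneForm_pullback`) and
differentiability of `ω` (`diffFormAt_modelForm`), which has to be extracted from the smoothness of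
`D` and local triviality. -/

noncomputable section

/-! ### Derivatives as maps between the model spaces -/

section MDeriv

variable {E F K : Type*} [NormedAddCommGroup E] [NormedSpace ℝ E]
  [NormedAddCommGroup F] [NormedSpace ℝ F] [NormedAddCommGroup K] [NormedSpace ℝ K]
  {M N Q : Type*} [TopologicalSpace M] [ChartedSpace E M] [TopologicalSpace N] [ChartedSpace F N]
  [TopologicalSpace Q] [ChartedSpace K Q]

/-- The differential of a map of manifolds at a point, as a map between the model spaces. -/
def mderiv (E F : Type*) [NormedAddCommGroup E] [NormedSpace ℝ E]
    [NormedAddCommGroup F] [NormedSpace ℝ F]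
    {M N : Type*} [TopologicalSpace M] [ChartedSpace E M] [TopologicalSpace N] [ChartedSpace F N]
    (f : M → N) (x : M) : E →L[ℝ] F :=
  mfderiv 𝓘(ℝ, E) 𝓘(ℝ, F) f x

/-- Every tangent space is definitionally the model space, so the transport between tangent spaces
at equal points disappears there. This is why the proof computes with `mderiv`. -/
theorem tanCast_apply {x y : M} (h : x = y) (v : E) :
    (tanCast (E := E) h (v : Tan E x) : E) = v := by
  subst h; rfl

theorem mderiv_comp {g : N → Q} {f : M → N} {x : M}
    (hg : MDifferentiableAt 𝓘(ℝ, F) 𝓘(ℝ, K) g (f x))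
    (hf : MDifferentiableAt 𝓘(ℝ, E) 𝓘(ℝ, F) f x) :
    mderiv E K (g ∘ f) x = (mderiv F K g (f x)).comp (mderiv E F f x) :=
  mfderiv_comp x hg hf

theorem mderiv_id (x : M) : mderiv E E (id : M → M) x = ContinuousLinearMap.id ℝ E :=
  mfderiv_id

theorem mderiv_const (x : M) (y : N) : mderiv E F (fun _ : M => y) x = 0 :=
  mfderiv_const

theorem mderiv_congr {f g : M → N} {x : M} (h : f =ᶠ[𝓝 x] g) :
    mderiv E F f x = mderiv E F g x :=
  h.mfderiv_eq

theorem mderiv_eq_fderiv (f : E → F) (x : E) : mderiv E F f x = fderiv ℝ f x :=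
  mfderiv_eq_fderiv

theorem mderiv_chart_self [IsManifold 𝓘(ℝ, E) ∞ M] (x : M) :
    mderiv E E (extChartAt 𝓘(ℝ, E) x) x = ContinuousLinearMap.id ℝ E :=
  have : IsManifold 𝓘(ℝ, E) 1 M := IsManifold.of_le (n := ∞) (by simp)
  mfderiv_extChartAt_self

theorem contMDiffAt_chart_symm [IsManifold 𝓘(ℝ, E) ∞ M] (x : M) {y : E}
    (hy : y ∈ (extChartAt 𝓘(ℝ, E) x).target) :
    ContMDiffAt 𝓘(ℝ, E) 𝓘(ℝ, E) ∞ (extChartAt 𝓘(ℝ, E) x).symm y :=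
  (contMDiffOn_extChartAt_symm x).contMDiffAt ((isOpen_extChartAt_target x).mem_nhds hy)

theorem contMDiffAt_chart [IsManifold 𝓘(ℝ, E) ∞ M] (x : M) {y : M}
    (hy : y ∈ (extChartAt 𝓘(ℝ, E) x).source) :
    ContMDiffAt 𝓘(ℝ, E) 𝓘(ℝ, E) ∞ (extChartAt 𝓘(ℝ, E) x) y :=
  contMDiffAt_extChartAt' (by simpa using hy)

theorem mderiv_chart_symm_comp [IsManifold 𝓘(ℝ, E) ∞ M] (x : M) {y : M}
    (hy : y ∈ (extChartAt 𝓘(ℝ, E) x).source) (v : E) :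
    mderiv E E (extChartAt 𝓘(ℝ, E) x).symm (extChartAt 𝓘(ℝ, E) x y)
      (mderiv E E (extChartAt 𝓘(ℝ, E) x) y v) = v := by
  have h := mderiv_comp
    ((contMDiffAt_chart_symm x ((extChartAt 𝓘(ℝ, E) x).map_source hy)).mdifferentiableAt
      (by simp)) ((contMDiffAt_chart x hy).mdifferentiableAt (by simp))
  rw [mderiv_congr (g := id), mderiv_id] at h
  · exact (DFunLike.congr_fun h v).symm
  · filter_upwards [(isOpen_extChartAt_source x).mem_nhds hy] with z hz
    exact (extChartAt 𝓘(ℝ, E) x).left_inv hz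

theorem mderiv_chart_comp_symm [IsManifold 𝓘(ℝ, E) ∞ M] (x : M) {y : M}
    (hy : y ∈ (extChartAt 𝓘(ℝ, E) x).source) (v : E) :
    mderiv E E (extChartAt 𝓘(ℝ, E) x) y
      (mderiv E E (extChartAt 𝓘(ℝ, E) x).symm (extChartAt 𝓘(ℝ, E) x y) v) = v := by
  have hd := contMDiffAt_chart x hy
  rw [← (extChartAt 𝓘(ℝ, E) x).left_inv hy] at hd
  have h := mderiv_comp (hd.mdifferentiableAt (by simp))
    ((contMDiffAt_chart_symm x ((extChartAt 𝓘(ℝ, E) x).map_source hy)).mdifferentiableAt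
      (by simp))
  rw [(extChartAt 𝓘(ℝ, E) x).left_inv hy, mderiv_congr (g := id), mderiv_id] at h
  · exact (DFunLike.congr_fun h v).symm
  · filter_upwards [(isOpen_extChartAt_target x).mem_nhds
      ((extChartAt 𝓘(ℝ, E) x).map_source hy)] with z hz
    exact (extChartAt 𝓘(ℝ, E) x).right_inv hz

/-- The trivialization of the tangent bundle at `x` is, on fibres, the differential of the chart at
`x`. -/
theorem smoothFieldOn_iff_chart [IsManifold 𝓘(ℝ, E) ∞ M] (x : M) (V : M → E) {U : Set M}
    (hU : IsOpen U) (hs : U ⊆ (extChartAt 𝓘(ℝ, E) x).source) :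
    SmoothFieldOn E V U ↔
      ContMDiffOn 𝓘(ℝ, E) 𝓘(ℝ, E) ∞
        (fun y => mderiv E E (extChartAt 𝓘(ℝ, E) x) y (V y)) U := by
  have : IsManifold 𝓘(ℝ, E) 1 M := IsManifold.of_le (n := ∞) (by simp)
  have hs' : U ⊆ (chartAt E x).source := by rwa [extChartAt_source] at hs
  refine ((trivializationAt E (TangentSpace 𝓘(ℝ, E)) x).contMDiffOn_section_iff hU
    (by rwa [TangentBundle.trivializationAt_baseSet])).trans ?_
  have key : ∀ y ∈ U, ∀ v : TangentSpace 𝓘(ℝ, E) y,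
      (trivializationAt E (TangentSpace 𝓘(ℝ, E)) x ⟨y, v⟩).2 =
        (trivializationAt E (TangentSpace 𝓘(ℝ, E)) x).continuousLinearMapAt ℝ y v :=
      fun y hy v => by
    rw [Bundle.Trivialization.continuousLinearMapAt_apply,
      Bundle.Trivialization.coe_linearMapAt_of_mem]
    rw [TangentBundle.trivializationAt_baseSet]
    exact hs' hy
  exact contMDiffOn_congr fun y hy => (key y hy (V y)).trans
    (DFunLike.congr_fun (TangentBundle.continuousLinearMapAt_trivializationAt (hs' hy)) (V y))

theorem mderiv_comp₂ {J : Type*} [NormedAddCommGroup J] [NormedSpace ℝ J] {R : Type*}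
    [TopologicalSpace R] [ChartedSpace J R] {h : N → Q → R} {f : M → N} {g : M → Q} {x : M}
    (hh : MDifferentiableAt (𝓘(ℝ, F).prod 𝓘(ℝ, K)) 𝓘(ℝ, J) (uncurry h) (f x, g x))
    (hf : MDifferentiableAt 𝓘(ℝ, E) 𝓘(ℝ, F) f x) (hg : MDifferentiableAt 𝓘(ℝ, E) 𝓘(ℝ, K) g x)
    (w : E) :
    mderiv E J (fun q => h (f q) (g q)) x w =
      mderiv F J (fun z => h z (g x)) (f x) (mderiv E F f x w) +
        mderiv K J (fun z => h (f x) z) (g x) (mderiv E K g x w) := by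
  have h1 := hh.hasMFDerivAt.comp x (hf.hasMFDerivAt.prodMk hg.hasMFDerivAt)
  have h2 := DFunLike.congr_fun h1.mfderiv w
  refine h2.trans ?_
  exact mfderiv_prod_eq_add_apply hh
    (v := ((mderiv E F f x w, mderiv E K g x w) : F × K))

end MDeriv

theorem two_le_infty : (2 : WithTop ℕ∞) ≤ ∞ :=
  WithTop.coe_le_coe.2 (le_top : (2 : ℕ∞) ≤ ⊤)

/-! ### Naturality of the exterior derivative of one-forms -/

section ExtDeriv

variable {E F V W : Type*} [NormedAddCommGroup E] [NormedSpace ℝ E] [FiniteDimensional ℝ E]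
  [NormedAddCommGroup F] [NormedSpace ℝ F] [FiniteDimensional ℝ F]
  [NormedAddCommGroup V] [NormedSpace ℝ V] [NormedAddCommGroup W] [NormedSpace ℝ W]
  {M N : Type*} [TopologicalSpace M] [ChartedSpace E M] [TopologicalSpace N] [ChartedSpace F N]

theorem chartOneForm_apply (α : M → E →ₗ[ℝ] V) (x₀ : M) (y e : E) :
    chartOneForm (E := E) α x₀ y e =
      α ((extChartAt 𝓘(ℝ, E) x₀).symm y) (mderiv E E (extChartAt 𝓘(ℝ, E) x₀).symm y e) :=
  rfl

/-- The relation `f^*α = L ∘ β` read in charts. It is needed on a whole neighbourhood, since it is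
differentiated afterwards. -/
theorem eventually_chartOneForm_pullback [IsManifold 𝓘(ℝ, E) ∞ M] [IsManifold 𝓘(ℝ, F) ∞ N]
    {f : M → N} {U : Set M} (hU : IsOpen U) (hf : ContMDiffOn 𝓘(ℝ, E) 𝓘(ℝ, F) 2 f U)
    {x : M} (hx : x ∈ U) (α : N → F →ₗ[ℝ] V) (β : M → E →ₗ[ℝ] W) (L : W →ₗ[ℝ] V)
    (h : ∀ q ∈ U, ∀ w, α (f q) (mderiv E F f q w) = L (β q w)) :
    ∀ᶠ y in 𝓝 (extChartAt 𝓘(ℝ, E) x x), ∀ e,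
      chartOneForm (E := F) α (f x) (writtenInExtChartAt 𝓘(ℝ, E) 𝓘(ℝ, F) x f y)
        (fderiv ℝ (writtenInExtChartAt 𝓘(ℝ, E) 𝓘(ℝ, F) x f) y e) =
      L (chartOneForm (E := E) β x y e) := by
  set c := extChartAt 𝓘(ℝ, E) x with hc
  set d := extChartAt 𝓘(ℝ, F) (f x) with hd
  set Φ := writtenInExtChartAt 𝓘(ℝ, E) 𝓘(ℝ, F) x f with hΦ
  have hcx : c.symm (c x) = x := extChartAt_to_inv x
  have h1 : ∀ᶠ y in 𝓝 (c x), y ∈ c.target := extChartAt_target_mem_nhds x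
  have hcs : ContinuousAt c.symm (c x) := continuousAt_extChartAt_symm x
  have h2 : ∀ᶠ y in 𝓝 (c x), c.symm y ∈ U :=
    hcs.eventually_mem (by rw [hcx]; exact hU.mem_nhds hx)
  have hfx : ContinuousAt f x := (hf.contMDiffAt (hU.mem_nhds hx)).continuousAt
  have h3 : ∀ᶠ y in 𝓝 (c x), f (c.symm y) ∈ d.source := by
    have h4 : ContinuousAt (f ∘ c.symm) (c x) := by
      apply ContinuousAt.comp _ hcs
      rw [hcx]; exact hfx
    apply h4.eventually_mem
    rw [comp_apply, hcx]
    exact extChartAt_source_mem_nhds (f x)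
  filter_upwards [h1.eventually_nhds, h2, h3.eventually_nhds] with y hy1 hy2 hy3 e
  have hy1' := hy1.self_of_nhds
  have hy3' := hy3.self_of_nhds
  have hfy : ContMDiffAt 𝓘(ℝ, E) 𝓘(ℝ, F) 2 f (c.symm y) := hf.contMDiffAt (hU.mem_nhds hy2)
  have hsy : ContMDiffAt 𝓘(ℝ, E) 𝓘(ℝ, E) ∞ c.symm y := contMDiffAt_chart_symm x hy1'
  have hΦy : Φ y = d (f (c.symm y)) := rfl
  have hdΦ : d.symm (Φ y) = f (c.symm y) := by rw [hΦy, d.left_inv hy3']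
  have hΦs : ContMDiffAt 𝓘(ℝ, E) 𝓘(ℝ, F) 2 Φ y :=
    ((contMDiffAt_chart (f x) hy3').of_le two_le_infty).comp y
      (hfy.comp y (hsy.of_le two_le_infty))
  have e1 : mderiv E F (d.symm ∘ Φ) y = mderiv E F (f ∘ c.symm) y := by
    apply mderiv_congr
    filter_upwards [hy3] with z hz
    exact d.left_inv hz
  have hds : ContMDiffAt 𝓘(ℝ, F) 𝓘(ℝ, F) ∞ d.symm (Φ y) :=
    contMDiffAt_chart_symm (f x) (d.map_source hy3')
  rw [mderiv_comp (hds.mdifferentiableAt (by simp)) (hΦs.mdifferentiableAt (by simp)),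
    mderiv_comp (hfy.mdifferentiableAt (by simp)) (hsy.mdifferentiableAt (by simp))] at e1
  have e2 := DFunLike.congr_fun e1 e
  simp only [ContinuousLinearMap.comp_apply] at e2
  rw [chartOneForm_apply, chartOneForm_apply, ← mderiv_eq_fderiv, ← hd, e2, hdΦ]
  exact h _ hy2 _

omit [FiniteDimensional ℝ E] in
theorem extDeriv_compContinuousAlternatingMap {n : ℕ} {η : E → E [⋀^Fin n]→L[ℝ] W} {x : E}
    (hη : DifferentiableAt ℝ η x) (L : W →L[ℝ] V) :
    extDeriv (fun y => L.compContinuousAlternatingMap (η y)) x =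
      L.compContinuousAlternatingMap (extDeriv η x) := by
  have h2 : DifferentiableAt ℝ (fun y => L.compContinuousAlternatingMap (η y)) x :=
    (L.compContinuousAlternatingMapCLM ℝ E W V (Fin n)).differentiableAt.comp x hη
  ext v
  rw [extDeriv_apply h2, ContinuousLinearMap.compContinuousAlternatingMap_coe, comp_apply,
    extDeriv_apply hη, map_sum]
  refine Finset.sum_congr rfl fun i _ => ?_
  rw [map_zsmul]
  congr 1
  have h3 : DifferentiableAt ℝ (fun y => η y (i.removeNth v)) x := by fun_prop
  exact DFunLike.congr_fun (fderiv_comp x L.differentiableAt h3) (v i) |>.trans (by simp)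

omit [FiniteDimensional ℝ E] in
-- As `F` has finite dimension, a linear map out of it amounts to its finitely many values on a
-- basis.
theorem contDiffAt_clm_of_apply {f : E → F →L[ℝ] V} {x : E} {n : WithTop ℕ∞}
    (h : ∀ v, ContDiffAt ℝ n (fun y => f y v) x) : ContDiffAt ℝ n f x := by
  let e₁ : F ≃L[ℝ] (Fin (Module.finrank ℝ F) → ℝ) :=
    ContinuousLinearEquiv.ofFinrankEq (Module.finrank_fin_fun ℝ).symm
  let e₂ := (e₁.arrowCongr (1 : V ≃L[ℝ] V)).trans
    (ContinuousLinearEquiv.piRing (Fin (Module.finrank ℝ F)))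
  rw [← id_comp f, ← e₂.symm_comp_self]
  exact e₂.symm.contDiff.contDiffAt.comp x (contDiffAt_pi.2 fun i => h _)

/-- A one-form is differentiable at `x` if it is so in the chart around `x`. -/
def DiffFormAt (α : M → E →ₗ[ℝ] V) (x : M) : Prop :=
  DifferentiableAt ℝ (chartOneForm (E := E) α x) (extChartAt 𝓘(ℝ, E) x x)

theorem DiffFormAt.ofSubsingleton {α : M → E →ₗ[ℝ] V} {x : M} (h : DiffFormAt α x) :
    DifferentiableAt ℝ (fun y => ContinuousAlternatingMap.ofSubsingleton ℝ E V (0 : Fin 1)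
      (chartOneForm (E := E) α x y)) (extChartAt 𝓘(ℝ, E) x x) :=
  (ContinuousAlternatingMap.ofSubsingletonLIE (𝕜 := ℝ) (E := E) (F := V) (0 : Fin 1)).differentiableAt.comp _ h

/-- The differential of the chart around `x` at `x` itself is the identity of the model space. -/
theorem extDerivOneForm_apply [IsManifold 𝓘(ℝ, E) ∞ M] (α : M → E →ₗ[ℝ] V) (x : M)
    (w : Fin 2 → E) :
    extDerivOneForm (E := E) α x w =
      extDeriv (fun y => ContinuousAlternatingMap.ofSubsingleton ℝ E V (0 : Fin 1)
        (chartOneForm (E := E) α x y)) (extChartAt 𝓘(ℝ, E) x x) w := by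
  change extDeriv _ _ (fun i => mderiv E E (extChartAt 𝓘(ℝ, E) x) x (w i)) = _
  rw [mderiv_chart_self]
  rfl

omit [FiniteDimensional ℝ E] [FiniteDimensional ℝ F] in
theorem fderiv_writtenInExtChartAt {f : M → N} {x : M}
    (hf : MDifferentiableAt 𝓘(ℝ, E) 𝓘(ℝ, F) f x) :
    fderiv ℝ (writtenInExtChartAt 𝓘(ℝ, E) 𝓘(ℝ, F) x f) (extChartAt 𝓘(ℝ, E) x x) =
      mderiv E F f x := by
  rw [mderiv, hf.mfderiv, modelWithCornersSelf_coe, range_id, fderivWithin_univ]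

/-- Both sides are exterior derivatives of the same form on the model space, by naturality there;
naturality rests on the symmetry of second derivatives, hence the order 2 for `f`. The factor `L`
covers both uses: `Ad_{g⁻¹}` for right translations and the identity for arrows. -/
theorem extDerivOneForm_pullback [FiniteDimensional ℝ W]
    [IsManifold 𝓘(ℝ, E) ∞ M] [IsManifold 𝓘(ℝ, F) ∞ N]
    {f : M → N} {U : Set M} (hU : IsOpen U) (hf : ContMDiffOn 𝓘(ℝ, E) 𝓘(ℝ, F) 2 f U)
    {x : M} (hx : x ∈ U) (α : N → F →ₗ[ℝ] V) (β : M → E →ₗ[ℝ] W) (L : W →ₗ[ℝ] V)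
    (h : ∀ q ∈ U, ∀ w, α (f q) (mderiv E F f q w) = L (β q w))
    (hα : DiffFormAt α (f x)) (hβ : DiffFormAt β x) (w : Fin 2 → E) :
    extDerivOneForm (E := F) α (f x) (fun i => mderiv E F f x (w i)) =
      L (extDerivOneForm (E := E) β x w) := by
  set Φ := writtenInExtChartAt 𝓘(ℝ, E) 𝓘(ℝ, F) x f with hΦ
  have hfx : ContMDiffAt 𝓘(ℝ, E) 𝓘(ℝ, F) 2 f x := hf.contMDiffAt (hU.mem_nhds hx)
  have hΦx : Φ (extChartAt 𝓘(ℝ, E) x x) = extChartAt 𝓘(ℝ, F) (f x) (f x) := by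
    simp [hΦ, writtenInExtChartAt]
  have hΦs : ContDiffAt ℝ 2 Φ (extChartAt 𝓘(ℝ, E) x x) := by
    have := (contMDiffAt_iff.1 hfx).2
    rwa [modelWithCornersSelf_coe, range_id, contDiffWithinAt_univ] at this
  have hα' := hα.ofSubsingleton
  rw [← hΦx] at hα'
  have key := extDeriv_pullback hα' hΦs
    (by rw [minSmoothness_of_isRCLikeNormedField])
  rw [fderiv_writtenInExtChartAt (hfx.mdifferentiableAt (by simp)), hΦx] at key
  have hev := eventually_chartOneForm_pullback hU hf hx α β L h
  have hev2 : (fun y => (ContinuousAlternatingMap.ofSubsingleton ℝ F V (0 : Fin 1)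
        (chartOneForm (E := F) α (f x) (Φ y))).compContinuousLinearMap (fderiv ℝ Φ y))
      =ᶠ[𝓝 (extChartAt 𝓘(ℝ, E) x x)]
      fun y => L.toContinuousLinearMap.compContinuousAlternatingMap
        (ContinuousAlternatingMap.ofSubsingleton ℝ E W (0 : Fin 1)
          (chartOneForm (E := E) β x y)) := by
    filter_upwards [hev] with y hy
    ext v
    exact hy (v 0)
  rw [hev2.extDeriv_eq, extDeriv_compContinuousAlternatingMap hβ.ofSubsingleton] at key
  rw [extDerivOneForm_apply, extDerivOneForm_apply]
  exact (DFunLike.congr_fun key w).symm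

end ExtDeriv

/-! ### Vertical vectors of a principal bundle -/

namespace GroupoidBundle

section

variable {E₀ E₁ : Type*} [NormedAddCommGroup E₀] [NormedSpace ℝ E₀]
  [NormedAddCommGroup E₁] [NormedSpace ℝ E₁]
  {X₀ X₁ : Type*} [TopologicalSpace X₀] [ChartedSpace E₀ X₀]
  [TopologicalSpace X₁] [ChartedSpace E₁ X₁] {𝕏 : LieGroupoid E₀ E₁ X₀ X₁}
  {EP EG : Type*} [NormedAddCommGroup EP] [NormedSpace ℝ EP]
  [NormedAddCommGroup EG] [NormedSpace ℝ EG]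
  {P G : Type*} [TopologicalSpace P] [ChartedSpace EP P]
  [TopologicalSpace G] [ChartedSpace EG G] [Group G]

theorem dπ_apply (B : GroupoidBundle 𝕏 EP EG P G) {x : X₀} (p : B.Fiber x) (w : EP) :
    (B.dπ p w : E₀) = mderiv EP E₀ B.π p.1 w :=
  tanCast_apply _ _

/-- The infinitesimal action at `p` as a map of the model spaces. -/
def vert (B : GroupoidBundle 𝕏 EP EG P G) (p : P) : EG →L[ℝ] EP :=
  mderiv EG EP (fun g => B.act p g) 1

theorem infAct_apply (B : GroupoidBundle 𝕏 EP EG P G) (p : P) (A : EG) :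
    (B.infAct p A : EP) = B.vert p A :=
  tanCast_apply _ _

theorem contMDiff_act_left (B : GroupoidBundle 𝕏 EP EG P G) (p : P) :
    ContMDiff 𝓘(ℝ, EG) 𝓘(ℝ, EP) ∞ (fun g => B.act p g) :=
  B.smooth_act.comp (contMDiff_const.prodMk contMDiff_id)

theorem contMDiff_act_right (B : GroupoidBundle 𝕏 EP EG P G) (g : G) :
    ContMDiff 𝓘(ℝ, EP) 𝓘(ℝ, EP) ∞ (fun p => B.act p g) :=
  B.smooth_act.comp (contMDiff_id.prodMk contMDiff_const)

theorem exists_mem_fiber (B : GroupoidBundle 𝕏 EP EG P G) (x : X₀) : ∃ p, B.π p = x := by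
  obtain ⟨U, ψ, χ, -, hx, -, -, h, -⟩ := B.locally_trivial x
  exact ⟨ψ x 1, (h x hx 1).1⟩

/-- The orbit of `p` stays in one fibre, so `π` is constant along it. -/
theorem mderiv_π_vert (B : GroupoidBundle 𝕏 EP EG P G) (p : P) (A : EG) :
    mderiv EP E₀ B.π p (B.vert p A) = 0 := by
  have h := mderiv_comp (g := B.π) (f := fun g => B.act p g) (x := (1 : G))
    (B.smooth_π.mdifferentiable (by simp) _)
    ((B.contMDiff_act_left p).mdifferentiable (by simp) _)
  have h2 : B.π ∘ (fun g => B.act p g) = fun _ => B.π p := funext fun g => B.π_act p g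
  rw [h2, mderiv_const, B.act_one] at h
  exact (DFunLike.congr_fun h A).symm

/-- Over a neighbourhood of each point of the base there is a smooth equivariant map `χ` to the
group, whose differential inverts the infinitesimal action on vertical vectors. -/
theorem exists_equivariant_map [LieGroup 𝓘(ℝ, EG) ∞ G] (B : GroupoidBundle 𝕏 EP EG P G)
    (x₀ : X₀) :
    ∃ (U : Set X₀) (χ : P → G), IsOpen U ∧ x₀ ∈ U ∧
      ContMDiffOn 𝓘(ℝ, EP) 𝓘(ℝ, EG) ∞ χ (B.π ⁻¹' U) ∧
      (∀ p ∈ B.π ⁻¹' U, ∀ A, mderiv EP EG (fun q => (χ p)⁻¹ * χ q) p (B.vert p A) = A) ∧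
      ∀ p ∈ B.π ⁻¹' U, ∀ w, mderiv EP E₀ B.π p w = 0 →
        B.vert p (mderiv EP EG (fun q => (χ p)⁻¹ * χ q) p w) = w := by
  obtain ⟨U, ψ, χ, hU, hx₀, hψ, hχ, h1, h2, h3⟩ := B.locally_trivial x₀
  -- In the trivialization `G` acts by right multiplication on the second coordinate.
  have hact : ∀ p ∈ B.π ⁻¹' U, ∀ g, B.act p g = ψ (B.π p) (χ p * g) := fun p hp g => by
    rw [h3 _ hp, h2 _ hp]
  have hV : IsOpen (B.π ⁻¹' U) := hU.preimage B.smooth_π.continuous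
  have hκ : ∀ p ∈ B.π ⁻¹' U, ContMDiffAt 𝓘(ℝ, EP) 𝓘(ℝ, EG) ∞ (fun q => (χ p)⁻¹ * χ q) p :=
    fun p hp => contMDiffAt_const.mul (hχ.contMDiffAt (hV.mem_nhds hp))
  refine ⟨U, χ, hU, hx₀, hχ, fun p hp A => ?_, fun p hp w hw => ?_⟩
  · have hκ1 := (hκ p hp).mdifferentiableAt (by simp)
    rw [← B.act_one p] at hκ1
    have h := mderiv_comp (f := fun g => B.act p g) (x := (1 : G)) hκ1
      ((B.contMDiff_act_left p).mdifferentiable (by simp) _)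
    rw [B.act_one] at h
    -- Along the orbit, `χ(p)⁻¹ χ(p · g) = g`; differentiating at `g = 1` gives the identity.
    have h4 : (fun q => (χ p)⁻¹ * χ q) ∘ (fun g => B.act p g) = id := funext fun g => by
      rw [comp_apply, hact p hp, (h1 _ hp _).2, inv_mul_cancel_left, id]
    rw [h4, mderiv_id] at h
    exact (DFunLike.congr_fun h A).symm
  -- Differentiating `ψ(π q, χ q) = q` along a vertical `w` leaves only the partial derivative of
  -- `ψ` in the group variable (`ha`). That is the differential of `q ↦ p · (χ(p)⁻¹ χ(q)) = ψ(π p, χ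
  -- q)`, computed by the chain rule in `hb`.
  · have hψ1 : ContMDiffAt (𝓘(ℝ, E₀).prod 𝓘(ℝ, EG)) 𝓘(ℝ, EP) ∞ (uncurry ψ) (B.π p, χ p) :=
      hψ.contMDiffAt ((hU.prod isOpen_univ).mem_nhds ⟨hp, mem_univ _⟩)
    have hχ1 : ContMDiffAt 𝓘(ℝ, EP) 𝓘(ℝ, EG) ∞ χ p := hχ.contMDiffAt (hV.mem_nhds hp)
    have ha := mderiv_comp₂ (hψ1.mdifferentiableAt (by simp))
      (B.smooth_π.mdifferentiable (by simp) p) (hχ1.mdifferentiableAt (by simp)) w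
    rw [mderiv_congr (g := id), mderiv_id, hw, map_zero, zero_add] at ha
    swap
    · filter_upwards [hV.mem_nhds hp] with q hq using h2 q hq
    have hκp : (χ p)⁻¹ * χ p = 1 := inv_mul_cancel _
    have hb := mderiv_comp (g := fun g => B.act p g) (f := fun q => (χ p)⁻¹ * χ q) (x := p)
      ((B.contMDiff_act_left p).mdifferentiable (by simp) _)
      ((hκ p hp).mdifferentiableAt (by simp))
    have hc : (fun g => B.act p g) ∘ (fun q => (χ p)⁻¹ * χ q) = (fun g => ψ (B.π p) g) ∘ χ :=
      funext fun q => by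
        rw [comp_apply, hact p hp, mul_inv_cancel_left, comp_apply]
    have hψ2 : ContMDiffAt 𝓘(ℝ, EG) 𝓘(ℝ, EP) ∞ (fun g => ψ (B.π p) g) (χ p) :=
      hψ1.comp (χ p) (contMDiffAt_const.prodMk contMDiffAt_id)
    rw [hκp, hc, mderiv_comp (hψ2.mdifferentiableAt (by simp))
      (hχ1.mdifferentiableAt (by simp))] at hb
    have hd := DFunLike.congr_fun hb w
    rw [vert]
    exact hd.symm.trans ha.symm

theorem vert_injective [LieGroup 𝓘(ℝ, EG) ∞ G] (B : GroupoidBundle 𝕏 EP EG P G) (p : P) :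
    Injective (B.vert p) := by
  obtain ⟨U, χ, -, hx, -, h, -⟩ := B.exists_equivariant_map (B.π p)
  intro A A' hA
  rw [← h p hx A, hA, h p hx]

variable [IsManifold 𝓘(ℝ, E₁) ∞ X₁]

/-! ### Horizontal and vertical components, and the connection form -/

namespace Connection

variable [IsManifold 𝓘(ℝ, E₀) ∞ X₀] [IsManifold 𝓘(ℝ, EP) ∞ P]
  {B : GroupoidBundle 𝕏 EP EG P G} {𝓗 : 𝕏.Connection}

/-- The horizontal lift at a point of the bundle, as a map of the model spaces. -/
def hlift (D : B.Connection 𝓗) (p : P) : E₀ →ₗ[ℝ] EP := D.lift (x := B.π p) ⟨p, rfl⟩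

/-- The connection form, as a map of the model spaces. -/
def modelForm (D : B.Connection 𝓗) (p : P) : EP →ₗ[ℝ] EG := D.form p

theorem lift_apply (D : B.Connection 𝓗) {x : X₀} (p : B.Fiber x) (v : E₀) :
    (D.lift p v : EP) = D.hlift p.1 v := by
  obtain ⟨p, rfl⟩ := p
  rfl

theorem mderiv_π_hlift (D : B.Connection 𝓗) (p : P) (v : E₀) :
    mderiv EP E₀ B.π p (D.hlift p v) = v :=
  (B.dπ_apply ⟨p, rfl⟩ _).symm.trans (D.splits (B.π p) ⟨p, rfl⟩ v)

theorem hlift_act (D : B.Connection 𝓗) (p : P) (g : G) (v : E₀) :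
    D.hlift (B.act p g) v = mderiv EP EP (fun q => B.act q g) p (D.hlift p v) :=
  (D.lift_apply (B.fiberAct (x := B.π p) ⟨p, rfl⟩ g) v).symm.trans
    ((D.D (B.π p) v).2 ⟨p, rfl⟩ g)

variable [LieGroup 𝓘(ℝ, EG) ∞ G]

/-- The form is defined through `LinearMap.leftInverse`, which inverts the infinitesimal action only
because the latter is injective. All later values of `ω` come from this lemma. -/
theorem modelForm_sub (D : B.Connection 𝓗) (p : P) (A : EG) (w : EP)
    (h : w - D.hlift p (mderiv EP E₀ B.π p w) = B.vert p A) : D.modelForm p w = A := by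
  have h1 : LinearMap.ker (B.infAct p) = ⊥ := by
    refine LinearMap.ker_eq_bot.2 fun A A' hA => B.vert_injective p ?_
    exact (B.infAct_apply p A).symm.trans (hA.trans (B.infAct_apply p A'))
  have h2 := LinearMap.leftInverse_apply_of_inj h1 A
  refine Eq.trans ?_ h2
  change (B.infAct p).leftInverse (w - D.hlift p (B.dπ (x := B.π p) ⟨p, rfl⟩ w)) = _
  refine congrArg (B.infAct p).leftInverse ?_
  exact h.trans (B.infAct_apply p A).symm

theorem modelForm_hlift (D : B.Connection 𝓗) (p : P) (v : E₀) :
    D.modelForm p (D.hlift p v) = 0 :=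
  D.modelForm_sub p 0 _ (by rw [mderiv_π_hlift, sub_self, map_zero])

theorem modelForm_vert (D : B.Connection 𝓗) (p : P) (A : EG) :
    D.modelForm p (B.vert p A) = A :=
  D.modelForm_sub p A _ (by rw [mderiv_π_vert, map_zero, sub_zero])

/-- The difference of `w` and the lift of its projection is killed by `dπ`, and local triviality
makes such vectors fundamental. -/
theorem hlift_add_vert (D : B.Connection 𝓗) (p : P) (w : EP) :
    D.hlift p (mderiv EP E₀ B.π p w) + B.vert p (D.modelForm p w) = w := by
  obtain ⟨U, χ, -, hx, -, -, h⟩ := B.exists_equivariant_map (B.π p)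
  have h1 := h p hx (w - D.hlift p (mderiv EP E₀ B.π p w))
    (by rw [map_sub, mderiv_π_hlift, sub_self])
  rw [D.modelForm_sub p _ w h1.symm, h1, add_sub_cancel]

/-- A map of `P` to itself that covers some map of the base, is compatible with horizontal lifts,
and transforms vertical vectors by a linear map `L` of the Lie algebra, transforms the connection
form by `L`. -/
theorem modelForm_comp (D : B.Connection 𝓗) {f : P → P} {p : P} (L : EG →ₗ[ℝ] EG)
    (θ : E₀ → E₀)
    (hh : ∀ v, mderiv EP EP f p (D.hlift p v) = D.hlift (f p) (θ v))
    (hv : ∀ A, mderiv EP EP f p (B.vert p A) = B.vert (f p) (L A)) (w : EP) :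
    D.modelForm (f p) (mderiv EP EP f p w) = L (D.modelForm p w) := by
  conv_lhs => rw [← D.hlift_add_vert p w, map_add, hh, hv, map_add, modelForm_hlift,
    modelForm_vert, zero_add]

end Connection

end

end GroupoidBundle

/-! ### Differentiability of the connection form -/

namespace GroupoidBundle

section

variable {E₀ E₁ : Type*} [NormedAddCommGroup E₀] [NormedSpace ℝ E₀] [FiniteDimensional ℝ E₀]
  [NormedAddCommGroup E₁] [NormedSpace ℝ E₁]
  {X₀ X₁ : Type*} [TopologicalSpace X₀] [ChartedSpace E₀ X₀]
  [TopologicalSpace X₁] [ChartedSpace E₁ X₁] {𝕏 : LieGroupoid E₀ E₁ X₀ X₁}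
  {EP EG : Type*} [NormedAddCommGroup EP] [NormedSpace ℝ EP] [FiniteDimensional ℝ EP]
  [NormedAddCommGroup EG] [NormedSpace ℝ EG]
  {P G : Type*} [TopologicalSpace P] [ChartedSpace EP P]
  [TopologicalSpace G] [ChartedSpace EG G] [Group G]
  [IsManifold 𝓘(ℝ, E₁) ∞ X₁] [IsManifold 𝓘(ℝ, E₀) ∞ X₀] [IsManifold 𝓘(ℝ, EP) ∞ P]
  {B : GroupoidBundle 𝕏 EP EG P G} {𝓗 : 𝕏.Connection}

namespace Connection

omit [FiniteDimensional ℝ E₀] [FiniteDimensional ℝ EP] in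
/-- The horizontal lifts of the coordinate fields of a chart of the base, read in a chart of the
bundle, are smooth. -/
theorem contDiffAt_hlift_chart_apply (D : B.Connection 𝓗) (p : P) (u : E₀) :
    ContDiffAt ℝ ∞ (fun y =>
      mderiv EP EP (extChartAt 𝓘(ℝ, EP) p) ((extChartAt 𝓘(ℝ, EP) p).symm y)
        (D.hlift ((extChartAt 𝓘(ℝ, EP) p).symm y)
          (mderiv E₀ E₀ (extChartAt 𝓘(ℝ, E₀) (B.π p)).symm
            (extChartAt 𝓘(ℝ, E₀) (B.π p) (B.π ((extChartAt 𝓘(ℝ, EP) p).symm y))) u)))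
      (extChartAt 𝓘(ℝ, EP) p p) := by
  set c := extChartAt 𝓘(ℝ, EP) p with hc
  set d := extChartAt 𝓘(ℝ, E₀) (B.π p) with hd
  have hdo : IsOpen d.source := isOpen_extChartAt_source _
  -- The coordinate field with constant value `u` in the chart of the base is a smooth field to
  -- which the smoothness of `D` applies.
  have h1 : SmoothFieldOn E₀ (fun x : X₀ => mderiv E₀ E₀ d.symm (d x) u) d.source := by
    refine (smoothFieldOn_iff_chart (B.π p) _ hdo Subset.rfl).2 ?_
    refine (contMDiffOn_const (c := u)).congr fun y hy => ?_
    exact mderiv_chart_comp_symm (B.π p) hy u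
  have h2 := D.smooth_D d.source _ hdo h1
  have hU : IsOpen (B.π ⁻¹' d.source ∩ c.source) :=
    (hdo.preimage B.smooth_π.continuous).inter (isOpen_extChartAt_source p)
  have hpU : p ∈ B.π ⁻¹' d.source ∩ c.source :=
    ⟨mem_extChartAt_source (I := 𝓘(ℝ, E₀)) (B.π p), mem_extChartAt_source (I := 𝓘(ℝ, EP)) p⟩
  have h3 := (smoothFieldOn_iff_chart p
    (fun q => D.hlift q (mderiv E₀ E₀ d.symm (d (B.π q)) u)) hU inter_subset_right).1
    (ContMDiffOn.mono h2 inter_subset_left)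
  have hcp : c.symm (c p) = p := extChartAt_to_inv p
  have h4 : ContMDiffAt 𝓘(ℝ, EP) 𝓘(ℝ, EP) ∞
      (fun q => mderiv EP EP c q (D.hlift q (mderiv E₀ E₀ d.symm (d (B.π q)) u)))
      (c.symm (c p)) := by
    rw [hcp]; exact h3.contMDiffAt (hU.mem_nhds hpU)
  exact (h4.comp (c p) (contMDiffAt_chart_symm p (mem_extChartAt_target p))).contDiffAt

variable [LieGroup 𝓘(ℝ, EG) ∞ G]

/-- Near `p`, `ω` at `q` is the differential at `q` of `χ(q)⁻¹ χ`, applied to the vertical part `w -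
hlift(dπ w)`. In charts each factor is smooth, so the product is. -/
theorem diffFormAt_modelForm (D : B.Connection 𝓗) (p : P) : DiffFormAt D.modelForm p := by
  obtain ⟨U, χ, hU, hpU, hχ, -, hvert⟩ := B.exists_equivariant_map (B.π p)
  set c := extChartAt 𝓘(ℝ, EP) p with hc
  set d := extChartAt 𝓘(ℝ, E₀) (B.π p) with hd
  set a := extChartAt 𝓘(ℝ, EG) (1 : G) with ha
  have hcp : c.symm (c p) = p := extChartAt_to_inv p
  have hcs : ContMDiffAt 𝓘(ℝ, EP) 𝓘(ℝ, EP) ∞ c.symm (c p) :=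
    contMDiffAt_chart_symm p (mem_extChartAt_target p)
  have hV : IsOpen (B.π ⁻¹' U) := hU.preimage B.smooth_π.continuous
  have hχc : ContMDiffAt 𝓘(ℝ, EP) 𝓘(ℝ, EG) ∞ (χ ∘ c.symm) (c p) := by
    refine ContMDiffAt.comp (c p) ?_ hcs
    rw [hcp]
    exact hχ.contMDiffAt (hV.mem_nhds hpU)
  -- the map to the group, in charts
  let k : EP → EP → EG := fun y z => a ((χ (c.symm y))⁻¹ * χ (c.symm z))
  have hk : ContDiffAt ℝ ∞ (uncurry k) (c p, c p) := by
    have h1 : ContMDiffAt 𝓘(ℝ, EP × EP) 𝓘(ℝ, EG) ∞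
        (fun z : EP × EP => (χ (c.symm z.1))⁻¹ * χ (c.symm z.2)) (c p, c p) := by
      refine ContMDiffAt.mul (ContMDiffAt.inv ?_) ?_
      · exact ContMDiffAt.comp (c p, c p) (g := χ ∘ c.symm) (f := Prod.fst) hχc
          contDiff_fst.contMDiff.contMDiffAt
      · exact ContMDiffAt.comp (c p, c p) (g := χ ∘ c.symm) (f := Prod.snd) hχc
          contDiff_snd.contMDiff.contMDiffAt
    refine (ContMDiffAt.comp (c p, c p) (g := a) ?_ h1).contDiffAt
    simp only [inv_mul_cancel]
    exact contMDiffAt_chart 1 (mem_extChartAt_source 1)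
  have hk' : ContDiffAt ℝ ∞ (fun y => fderiv ℝ (k y) y) (c p) :=
    ContDiffAt.fderiv hk contDiffAt_id (by simp)
  -- the horizontal lift, in charts
  let H : EP → E₀ →L[ℝ] EP := fun y => LinearMap.toContinuousLinearMap
    ((mderiv EP EP c (c.symm y)).toLinearMap ∘ₗ D.hlift (c.symm y) ∘ₗ
      (mderiv E₀ E₀ d.symm (d (B.π (c.symm y)))).toLinearMap)
  have hH : ContDiffAt ℝ ∞ H (c p) :=
    contDiffAt_clm_of_apply fun u => D.contDiffAt_hlift_chart_apply p u
  -- the projection, in charts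
  let Q : EP → E₀ := d ∘ B.π ∘ c.symm
  have hQ : ContDiffAt ℝ ∞ Q (c p) := by
    refine (ContMDiffAt.comp (c p) ?_ (B.smooth_π.contMDiffAt.comp (c p) hcs)).contDiffAt
    rw [comp_apply, hcp]
    exact contMDiffAt_chart _ (mem_extChartAt_source _)
  have hQ' : ContDiffAt ℝ ∞ (fderiv ℝ Q) (c p) := hQ.fderiv_right (by simp)
  have hfin : ContDiffAt ℝ ∞ (fun y => (fderiv ℝ (k y) y).comp
      (ContinuousLinearMap.id ℝ EP - (H y).comp (fderiv ℝ Q y))) (c p) :=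
    hk'.clm_comp (contDiffAt_const.sub (hH.clm_comp hQ'))
  refine (hfin.differentiableAt (by simp)).congr_of_eventuallyEq ?_
  have e1 : ∀ᶠ y in 𝓝 (c p), y ∈ c.target := extChartAt_target_mem_nhds p
  have e2 : ∀ᶠ y in 𝓝 (c p), c.symm y ∈ B.π ⁻¹' U ∩ B.π ⁻¹' d.source := by
    refine hcs.continuousAt.eventually_mem ?_
    rw [hcp]
    exact (hV.inter ((isOpen_extChartAt_source _).preimage B.smooth_π.continuous)).mem_nhds
      ⟨hpU, mem_extChartAt_source (I := 𝓘(ℝ, E₀)) (B.π p)⟩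
  filter_upwards [e1, e2] with y hy ⟨hyU, hyd⟩
  ext e
  rw [chartOneForm_apply]
  set q := c.symm y with hq
  set w := mderiv EP EP c.symm y e with hw
  have hqs : q ∈ c.source := c.map_target hy
  have hcq : c q = y := c.right_inv hy
  have hsy : ContMDiffAt 𝓘(ℝ, EP) 𝓘(ℝ, EP) ∞ c.symm y := contMDiffAt_chart_symm p hy
  have hdq : ContMDiffAt 𝓘(ℝ, E₀) 𝓘(ℝ, E₀) ∞ d (B.π q) := contMDiffAt_chart _ hyd
  -- the vertical part of `w`
  have hπw : mderiv E₀ E₀ d.symm (d (B.π q)) (fderiv ℝ Q y e) = mderiv EP E₀ B.π q w := by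
    have h1 : mderiv EP E₀ Q y = (mderiv E₀ E₀ d (B.π q)).comp
        ((mderiv EP E₀ B.π q).comp (mderiv EP EP c.symm y)) := by
      rw [← mderiv_comp (B.smooth_π.mdifferentiable (by simp) _) (hsy.mdifferentiableAt (by simp))]
      exact mderiv_comp (f := B.π ∘ c.symm) (hdq.mdifferentiableAt (by simp))
        ((B.smooth_π.contMDiffAt.comp y hsy).mdifferentiableAt (by simp))
    rw [← mderiv_eq_fderiv, h1]
    exact mderiv_chart_symm_comp _ hyd _
  have hHw : mderiv EP EP c.symm y (H y (fderiv ℝ Q y e)) =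
      D.hlift q (mderiv EP E₀ B.π q w) := by
    have h1 := mderiv_chart_symm_comp p hqs (D.hlift q (mderiv EP E₀ B.π q w))
    rw [← hc, hcq] at h1
    rw [← h1, ← hπw]
    rfl
  have hver := hvert q hyU (w - D.hlift q (mderiv EP E₀ B.π q w))
    (by rw [map_sub, mderiv_π_hlift, sub_self])
  rw [D.modelForm_sub q _ w hver.symm, ← hHw, hw, ← map_sub]
  -- the derivative of the map to the group
  have hκ : ContMDiffAt 𝓘(ℝ, EP) 𝓘(ℝ, EG) ∞ (fun q' => (χ q)⁻¹ * χ q') q :=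
    contMDiffAt_const.mul (hχ.contMDiffAt (hV.mem_nhds hyU))
  have hκy : ContMDiffAt 𝓘(ℝ, EP) 𝓘(ℝ, EG) ∞ ((fun q' => (χ q)⁻¹ * χ q') ∘ c.symm) y :=
    hκ.comp y hsy
  have ha1 : ContMDiffAt 𝓘(ℝ, EG) 𝓘(ℝ, EG) ∞ a
      (((fun q' => (χ q)⁻¹ * χ q') ∘ c.symm) y) := by
    rw [comp_apply, ← hq]
    simp only [inv_mul_cancel]
    exact contMDiffAt_chart 1 (mem_extChartAt_source 1)
  have h5 := mderiv_comp (ha1.mdifferentiableAt (by simp)) (hκy.mdifferentiableAt (by simp))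
  have h7 : mderiv EP EG ((fun q' => (χ q)⁻¹ * χ q') ∘ c.symm) y =
      (mderiv EP EG (fun q' => (χ q)⁻¹ * χ q') q).comp (mderiv EP EP c.symm y) :=
    mderiv_comp (hκ.mdifferentiableAt (by simp)) (hsy.mdifferentiableAt (by simp))
  -- The normalised map takes the value `1` at `q`, exactly where the chart `a` has identity
  -- differential; so `a` does not alter the derivative.
  have h8 : ((fun q' => (χ q)⁻¹ * χ q') ∘ c.symm) y = 1 := inv_mul_cancel _
  rw [h7, h8, ha, mderiv_chart_self] at h5
  have h6 := DFunLike.congr_fun h5 (e - H y (fderiv ℝ Q y e))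
  rw [mderiv_eq_fderiv] at h6
  exact h6.symm

end Connection

end

end GroupoidBundle

/-! ### Horizontal sections of the source map -/

namespace LieGroupoid.Connection

section

variable {E₀ E₁ : Type*} [NormedAddCommGroup E₀] [NormedSpace ℝ E₀]
  [NormedAddCommGroup E₁] [NormedSpace ℝ E₁]
  {X₀ X₁ : Type*} [TopologicalSpace X₀] [ChartedSpace E₀ X₀]
  [TopologicalSpace X₁] [ChartedSpace E₁ X₁] [IsManifold 𝓘(ℝ, E₁) ∞ X₁]
  {𝕏 : LieGroupoid E₀ E₁ X₀ X₁}

theorem bijective_domRestrict (𝓗 : 𝕏.Connection) (γ : X₁) :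
    Bijective ((tanMap E₁ E₀ 𝕏.s γ).domRestrict (𝓗.H γ)) :=
  ⟨LinearMap.injective_domRestrict_iff.2 (𝓗.isCompl γ).disjoint,
    (LinearMap.surjective_domRestrict_iff (𝕏.submersion_s γ)).2 (𝓗.isCompl γ).codisjoint⟩

/-- The horizontal lift along the source map, as a map of the model spaces. -/
def slift (𝓗 : 𝕏.Connection) (γ : X₁) : E₀ →ₗ[ℝ] E₁ := 𝕏.horLift 𝓗.H 𝓗.isCompl γ

theorem slift_eq (𝓗 : 𝕏.Connection) (γ : X₁) (v : E₁) (hv : v ∈ 𝓗.H γ) :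
    𝓗.slift γ (mderiv E₁ E₀ 𝕏.s γ v) = v := by
  have key : ∀ hb, (LinearEquiv.ofBijective ((tanMap E₁ E₀ 𝕏.s γ).domRestrict (𝓗.H γ)) hb).symm
      ((tanMap E₁ E₀ 𝕏.s γ).domRestrict (𝓗.H γ) ⟨v, hv⟩) = ⟨v, hv⟩ := fun hb =>
    LinearEquiv.ofBijective_symm_apply_apply _ _
  exact congrArg Subtype.val (key (𝓗.bijective_domRestrict γ))

theorem slift_proj (𝓗 : 𝕏.Connection) (γ : X₁) (v : E₁) :
    𝓗.slift γ (mderiv E₁ E₀ 𝕏.s γ (𝓗.proj γ v)) = 𝓗.proj γ v :=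
  𝓗.slift_eq γ _ (Submodule.projection_apply_mem _ _)

theorem exists_mem_H (𝓗 : 𝕏.Connection) (γ : X₁) (u : E₀) :
    ∃ v : E₁, v ∈ 𝓗.H γ ∧ mderiv E₁ E₀ 𝕏.s γ v = u := by
  have key : ∀ hb, (tanMap E₁ E₀ 𝕏.s γ).domRestrict (𝓗.H γ)
      ((LinearEquiv.ofBijective ((tanMap E₁ E₀ 𝕏.s γ).domRestrict (𝓗.H γ)) hb).symm u) = u :=
    fun hb => LinearEquiv.apply_ofBijective_symm_apply _ _
  exact ⟨𝓗.slift γ u, Subtype.coe_prop _, key (𝓗.bijective_domRestrict γ)⟩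

theorem injOn_H (𝓗 : 𝕏.Connection) (γ : X₁) (v : E₁) (hv : v ∈ 𝓗.H γ)
    (h : mderiv E₁ E₀ 𝕏.s γ v = 0) : v = 0 := by
  rw [← 𝓗.slift_eq γ v hv, h, map_zero]

/-- An integrable connection has, through each arrow `γ`, a local section of the source map all of
whose tangent vectors are horizontal. -/
theorem IsIntegrable.exists_section [FiniteDimensional ℝ E₀] [IsManifold 𝓘(ℝ, E₀) ∞ X₀]
    {𝓗 : 𝕏.Connection} (h : 𝓗.IsIntegrable) (γ : X₁) :
    ∃ (U : Set X₀) (S : X₀ → X₁), IsOpen U ∧ 𝕏.s γ ∈ U ∧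
      ContMDiffOn 𝓘(ℝ, E₀) 𝓘(ℝ, E₁) 2 S U ∧ S (𝕏.s γ) = γ ∧
      ∀ x ∈ U, 𝕏.s (S x) = x ∧ ∀ u, mderiv E₀ E₁ S x u = 𝓗.slift (S x) u := by
  obtain ⟨n, W, σ, hW, h0, hσ0, hσ, hσH⟩ := h γ
  set d := extChartAt 𝓘(ℝ, E₀) (𝕏.s γ) with hd
  set f : EuclideanSpace ℝ (Fin n) → E₀ := fun z => d (𝕏.s (σ z)) with hf
  have hσ' : ∀ z ∈ W, ContMDiffAt 𝓘(ℝ, EuclideanSpace ℝ (Fin n)) 𝓘(ℝ, E₁) ∞ σ z :=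
    fun z hz => hσ.contMDiffAt (hW.mem_nhds hz)
  have hs0 : 𝕏.s (σ 0) = 𝕏.s γ := by rw [hσ0]
  have hsd : 𝕏.s γ ∈ d.source := mem_extChartAt_source _
  have hd0 : ContMDiffAt 𝓘(ℝ, E₀) 𝓘(ℝ, E₀) ∞ d (𝕏.s (σ 0)) := by
    rw [hs0]; exact contMDiffAt_chart _ hsd
  have hsσ : ContMDiffAt 𝓘(ℝ, EuclideanSpace ℝ (Fin n)) 𝓘(ℝ, E₀) ∞ (𝕏.s ∘ σ) 0 :=
    (𝕏.smooth_s _).comp 0 (hσ' 0 h0)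
  have hfs : ContDiffAt ℝ ∞ f 0 := (hd0.comp (0 : EuclideanSpace ℝ (Fin n)) hsσ).contDiffAt
  -- A finite order is used because being `C²` at a point persists on a neighbourhood, whereas for
  -- `C^∞` at a point the neighbourhood may depend on the order. Order 2 is enough for naturality of
  -- `d`.
  have hfs2 : ContDiffAt ℝ 2 f 0 := hfs.of_le two_le_infty
  have hdf : fderiv ℝ f 0 = (mderiv E₁ E₀ 𝕏.s (σ 0)).comp
      (mderiv (EuclideanSpace ℝ (Fin n)) E₁ σ 0) := by
    rw [← mderiv_eq_fderiv]
    refine (mderiv_comp (f := 𝕏.s ∘ σ) (hd0.mdifferentiableAt (by simp))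
      (hsσ.mdifferentiableAt (by simp))).trans ?_
    rw [comp_apply, hs0, hd, mderiv_chart_self, ContinuousLinearMap.id_comp]
    exact mderiv_comp (𝕏.smooth_s.mdifferentiable (by simp) _)
      ((hσ' 0 h0).mdifferentiableAt (by simp))
  have hrange : ∀ z ∈ W, ∀ v : E₁, v ∈ 𝓗.H (σ z) ↔
      ∃ e, mderiv (EuclideanSpace ℝ (Fin n)) E₁ σ z e = v := fun z hz v => by
    rw [← (hσH z hz).2]; rfl
  -- `dσ` is an isomorphism onto `H` and `ds` restricts to an isomorphism from `H` to the tangent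
  -- space of the base. So the inverse function theorem applies to `f`, which is `s` along the
  -- integral manifold, and `σ` after the local inverse is the section.
  have hbij : Bijective (fderiv ℝ f 0) := by
    rw [hdf]
    constructor
    · refine (injective_iff_map_eq_zero _).2 fun e he => (hσH 0 h0).1 ?_
      exact (𝓗.injOn_H (σ 0) _ ((hrange 0 h0 _).2 ⟨e, rfl⟩) he).trans (map_zero _).symm
    · intro u
      obtain ⟨v, hv, hvu⟩ := 𝓗.exists_mem_H (σ 0) u
      obtain ⟨e, rfl⟩ := (hrange 0 h0 v).1 hv
      exact ⟨e, hvu⟩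
  let f' : EuclideanSpace ℝ (Fin n) ≃L[ℝ] E₀ :=
    (LinearEquiv.ofBijective (fderiv ℝ f 0).toLinearMap hbij).toContinuousLinearEquiv
  have hf' : HasFDerivAt f (f' : EuclideanSpace ℝ (Fin n) →L[ℝ] E₀) 0 := by
    have h1 : (f' : EuclideanSpace ℝ (Fin n) →L[ℝ] E₀) = fderiv ℝ f 0 := by ext; rfl
    rw [h1]
    exact (hfs.differentiableAt (by simp)).hasFDerivAt
  set g := hfs2.localInverse hf' (by simp) with hg
  have hf0 : f 0 = d (𝕏.s γ) := by simp only [hf, hs0]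
  have hg0 : g (d (𝕏.s γ)) = 0 := by
    rw [← hf0]; exact hfs2.localInverse_apply_image hf' (by simp)
  have hgs : ContDiffAt ℝ 2 g (d (𝕏.s γ)) := by
    rw [← hf0]; exact hfs2.to_localInverse hf' (by simp)
  have hgr : ∀ᶠ y in 𝓝 (d (𝕏.s γ)), f (g y) = y := by
    rw [← hf0]; exact (hfs2.hasStrictFDerivAt' hf' (by simp)).eventually_right_inverse
  have hgW : ∀ᶠ y in 𝓝 (d (𝕏.s γ)), g y ∈ W :=
    hgs.continuousAt.eventually_mem (by rw [hg0]; exact hW.mem_nhds h0)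
  have hgd : ∀ᶠ y in 𝓝 (d (𝕏.s γ)), 𝕏.s (σ (g y)) ∈ d.source := by
    have h1 : ContinuousAt (𝕏.s ∘ σ) (g (d (𝕏.s γ))) := by rw [hg0]; exact hsσ.continuousAt
    have h2 : ContinuousAt ((𝕏.s ∘ σ) ∘ g) (d (𝕏.s γ)) := h1.comp hgs.continuousAt
    refine h2.eventually_mem ?_
    rw [comp_apply, hg0, comp_apply, hs0]
    exact extChartAt_source_mem_nhds _
  obtain ⟨T, hT, hTo, hT0⟩ := eventually_nhds_iff.1
    (hgr.and (hgW.and (hgd.and (hgs.eventually (by simp)))))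
  set S : X₀ → X₁ := fun x => σ (g (d x)) with hS
  have hU : IsOpen (d.source ∩ d ⁻¹' T) :=
    (continuousOn_extChartAt _).isOpen_inter_preimage (isOpen_extChartAt_source _) hTo
  have hgdx : ∀ x ∈ d.source ∩ d ⁻¹' T,
      ContMDiffAt 𝓘(ℝ, E₀) 𝓘(ℝ, EuclideanSpace ℝ (Fin n)) 2 (g ∘ d) x := fun x hx =>
    (hT _ hx.2).2.2.2.contMDiffAt.comp x ((contMDiffAt_chart _ hx.1).of_le two_le_infty)
  have hSU : ∀ x ∈ d.source ∩ d ⁻¹' T, ContMDiffAt 𝓘(ℝ, E₀) 𝓘(ℝ, E₁) 2 S x := fun x hx =>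
    ContMDiffAt.comp (f := g ∘ d) x ((hσ' _ (hT _ hx.2).2.1).of_le two_le_infty) (hgdx x hx)
  have hsS : ∀ x ∈ d.source ∩ d ⁻¹' T, 𝕏.s (S x) = x := fun x hx =>
    d.injOn (hT _ hx.2).2.2.1 hx.1 (hT _ hx.2).1
  refine ⟨d.source ∩ d ⁻¹' T, S, hU, ⟨hsd, hT0⟩, fun x hx => (hSU x hx).contMDiffWithinAt,
    by simp only [hS, hg0, hσ0], fun x hx => ⟨hsS x hx, fun u => ?_⟩⟩
  have h1 : mderiv E₀ E₁ S x = (mderiv (EuclideanSpace ℝ (Fin n)) E₁ σ (g (d x))).comp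
      (mderiv E₀ (EuclideanSpace ℝ (Fin n)) (g ∘ d) x) :=
    mderiv_comp (f := g ∘ d) ((hσ' _ (hT _ hx.2).2.1).mdifferentiableAt (by simp))
      ((hgdx x hx).mdifferentiableAt (by simp))
  have h2 := mderiv_comp (𝕏.smooth_s.mdifferentiable (by simp) _)
    ((hSU x hx).mdifferentiableAt (by simp))
  rw [mderiv_congr (g := id), mderiv_id] at h2
  swap
  · filter_upwards [hU.mem_nhds hx] with z hz using hsS z hz
  have h3 : mderiv E₁ E₀ 𝕏.s (S x) (mderiv E₀ E₁ S x u) = u := (DFunLike.congr_fun h2 u).symm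
  have h4 : mderiv E₀ E₁ S x u ∈ 𝓗.H (S x) := by
    -- The section factors through `σ`, so its tangent vectors lie in `H`; with `ds ∘ dS = id` this
    -- forces them to be the horizontal lifts.
    refine (hrange _ (hT _ hx.2).2.1 _).2 ⟨mderiv E₀ (EuclideanSpace ℝ (Fin n)) (g ∘ d) x u, ?_⟩
    rw [h1]
    rfl
  rw [← 𝓗.slift_eq (S x) _ h4, h3]

end

end LieGroupoid.Connection

/-! ### The action of arrows on the bundle -/

namespace GroupoidBundle

section

variable {E₀ E₁ : Type*} [NormedAddCommGroup E₀] [NormedSpace ℝ E₀]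
  [NormedAddCommGroup E₁] [NormedSpace ℝ E₁]
  {X₀ X₁ : Type*} [TopologicalSpace X₀] [ChartedSpace E₀ X₀]
  [TopologicalSpace X₁] [ChartedSpace E₁ X₁] {𝕏 : LieGroupoid E₀ E₁ X₀ X₁}
  {EP EG : Type*} [NormedAddCommGroup EP] [NormedSpace ℝ EP]
  [NormedAddCommGroup EG] [NormedSpace ℝ EG]
  {P G : Type*} [TopologicalSpace P] [ChartedSpace EP P]
  [TopologicalSpace G] [ChartedSpace EG G] [Group G]

/-- The differential of the groupoid action along the fibre product. -/
def moveDeriv (B : GroupoidBundle 𝕏 EP EG P G) (γ : X₁) (p : P) : E₁ × EP →L[ℝ] EP :=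
  mfderivWithin (𝓘(ℝ, E₁).prod 𝓘(ℝ, EP)) 𝓘(ℝ, EP) (fun q : X₁ × P => B.μ q.1 q.2)
    {q | 𝕏.s q.1 = B.π q.2} (γ, p)

/-- The action is smooth only along the fibre product, so the chain rule first gives a derivative
within the set where `(a, b)` lies in it; that set is a neighbourhood of `x`. In particular the
values of `moveDeriv` on vectors tangent to such pairs do not depend on the derivative chosen within
the fibre product. -/
theorem mderiv_move (B : GroupoidBundle 𝕏 EP EG P G) {E : Type*} [NormedAddCommGroup E]
    [NormedSpace ℝ E] {M : Type*} [TopologicalSpace M] [ChartedSpace E M] {a : M → X₁} {b : M → P}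
    {x : M} (ha : MDifferentiableAt 𝓘(ℝ, E) 𝓘(ℝ, E₁) a x)
    (hb : MDifferentiableAt 𝓘(ℝ, E) 𝓘(ℝ, EP) b x) (h : ∀ᶠ z in 𝓝 x, 𝕏.s (a z) = B.π (b z))
    (w : E) :
    mderiv E EP (fun z => B.μ (a z) (b z)) x w =
      B.moveDeriv (a x) (b x) (mderiv E E₁ a x w, mderiv E EP b x w) := by
  have h1 := (B.smooth_μ.mdifferentiableOn (by simp) (a x, b x) h.self_of_nhds).hasMFDerivWithinAt
  have h2 := (ha.hasMFDerivAt.prodMk hb.hasMFDerivAt).hasMFDerivWithinAt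
    (s := {z | 𝕏.s (a z) = B.π (b z)})
  have h3 := (h1.comp x h2 (show {z | 𝕏.s (a z) = B.π (b z)} ⊆
    (fun z => (a z, b z)) ⁻¹' {q : X₁ × P | 𝕏.s q.1 = B.π q.2} from
      fun z hz => hz)).hasMFDerivAt h
  exact DFunLike.congr_fun h3.mfderiv w

/-- Differentiate `γ · (p · g) = (γ · p) · g` at `g = 1`. -/
theorem moveDeriv_vert (B : GroupoidBundle 𝕏 EP EG P G) {γ : X₁} {p : P} (h : 𝕏.s γ = B.π p)
    (A : EG) : B.moveDeriv γ p (0, B.vert p A) = B.vert (B.μ γ p) A := by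
  have h1 := B.mderiv_move (a := fun _ : G => γ) (b := fun g => B.act p g) (x := 1)
    mdifferentiableAt_const ((B.contMDiff_act_left p).mdifferentiable (by simp) _)
    (Filter.Eventually.of_forall fun g => h.trans (B.π_act p g).symm) A
  rw [mderiv_const, B.act_one] at h1
  refine h1.symm.trans ?_
  rw [vert]
  congr 2
  exact funext fun g => (B.μ_act γ p g h).symm

/-- Differentiate `(p · h) · g = (p · g) · (g⁻¹ h g)` at `h = 1`. -/
theorem mderiv_act_vert [LieGroup 𝓘(ℝ, EG) ∞ G] (B : GroupoidBundle 𝕏 EP EG P G) (p : P) (g : G)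
    (A : EG) :
    mderiv EP EP (fun q => B.act q g) p (B.vert p A) = B.vert (B.act p g) (lieAd EG g⁻¹ A) := by
  have h1 := mderiv_comp (g := fun q => B.act q g) (f := fun h => B.act p h) (x := (1 : G))
    ((B.contMDiff_act_right g).mdifferentiable (by simp) _)
    ((B.contMDiff_act_left p).mdifferentiable (by simp) _)
  have hc : ContMDiff 𝓘(ℝ, EG) 𝓘(ℝ, EG) ∞ (fun h : G => g⁻¹ * h * g⁻¹⁻¹) :=
    (contMDiff_const.mul contMDiff_id).mul contMDiff_const
  have h2 := mderiv_comp (g := fun h => B.act (B.act p g) h) (f := fun h => g⁻¹ * h * g⁻¹⁻¹)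
    (x := (1 : G)) ((B.contMDiff_act_left _).mdifferentiable (by simp) _)
    (hc.mdifferentiable (by simp) _)
  have h3 : (fun q => B.act q g) ∘ (fun h => B.act p h) =
      (fun h => B.act (B.act p g) h) ∘ (fun h => g⁻¹ * h * g⁻¹⁻¹) := funext fun h => by
    simp only [comp_apply, ← B.act_mul]
    congr 1
    group
  have h4 : g⁻¹ * 1 * g⁻¹⁻¹ = 1 := by group
  rw [B.act_one, h3, h2, h4] at h1
  have h5 : (lieAd EG g⁻¹ A : EG) = mderiv EG EG (fun h : G => g⁻¹ * h * g⁻¹⁻¹) 1 A :=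
    tanCast_apply _ _
  rw [h5]
  exact (DFunLike.congr_fun h1 A).symm

variable [IsManifold 𝓘(ℝ, E₁) ∞ X₁]

theorem thetaTilde_apply (B : GroupoidBundle 𝕏 EP EG P G) (𝓗 : 𝕏.Connection) (γ : X₁)
    (p : B.Fiber (𝕏.s γ)) (w : EP) :
    (B.thetaTilde 𝓗 γ p w : EP) =
      B.moveDeriv γ p.1 (𝓗.slift γ (mderiv EP E₀ B.π p.1 w), w) := by
  rw [← B.dπ_apply p]
  rfl

/-- A vertical vector has zero projection, so the component in `H` vanishes and only the commutation
of `μ` with `G` is left. -/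
theorem thetaTilde_infAct (B : GroupoidBundle 𝕏 EP EG P G) (𝓗 : 𝕏.Connection) (γ : X₁)
    (p : B.Fiber (𝕏.s γ)) (A : EG) :
    B.thetaTilde 𝓗 γ p (B.infAct p.1 A) = B.infAct (B.fiberMove γ p).1 A := by
  have h := B.thetaTilde_apply 𝓗 γ p (B.vert p.1 A)
  rw [mderiv_π_vert, map_zero, B.moveDeriv_vert p.2.symm] at h
  refine Eq.trans ?_ (h.trans (B.infAct_apply _ A).symm)
  exact congrArg (B.thetaTilde 𝓗 γ p) (B.infAct_apply p.1 A)

/-! ### Curvature under the actions of the group and of arrows -/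

namespace Connection

variable [IsManifold 𝓘(ℝ, E₀) ∞ X₀] [IsManifold 𝓘(ℝ, EP) ∞ P]
  {B : GroupoidBundle 𝕏 EP EG P G} {𝓗 : 𝕏.Connection}

theorem hlift_move (D : B.Connection 𝓗) {γ : X₁} {p : P} (h : 𝕏.s γ = B.π p) (v : E₀) :
    B.moveDeriv γ p (𝓗.slift γ v, D.hlift p v) =
      D.hlift (B.μ γ p) (mderiv E₁ E₀ 𝕏.t γ (𝓗.slift γ v)) := by
  have h1 := D.equivariant γ v ⟨p, h.symm⟩
  have h2 := D.lift_apply (B.fiberMove γ ⟨p, h.symm⟩) (mderiv E₁ E₀ 𝕏.t γ (𝓗.slift γ v))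
  have h3 := B.thetaTilde_apply 𝓗 γ ⟨p, h.symm⟩ (D.hlift p v)
  rw [mderiv_π_hlift] at h3
  refine h3.symm.trans (Eq.trans ?_ (h1.symm.trans h2))
  exact congrArg (B.thetaTilde 𝓗 γ ⟨p, h.symm⟩) (D.lift_apply ⟨p, h.symm⟩ v).symm

variable [FiniteDimensional ℝ EP] [FiniteDimensional ℝ EG] [LieGroup 𝓘(ℝ, EG) ∞ G]

/-- The exterior derivative of the connection form, on the horizontal lifts of vectors of the
base. -/
def liftedCurvature (D : B.Connection 𝓗) (p : P) (u : Fin 2 → E₀) : EG :=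
  extDerivOneForm (E := EP) D.modelForm p fun i => D.hlift p (u i)

/-- The connection form kills horizontal lifts, hence so does the bracket term. -/
theorem maurerCartan_hlift (D : B.Connection 𝓗) (p : P) (u : Fin 2 → E₀) :
    (D.maurerCartan p (fun i => D.hlift p (u i)) : EG) = D.liftedCurvature p u := by
  have : CompleteSpace EG := FiniteDimensional.complete ℝ EG
  have h : bracketForm (D.form p) (fun i => D.hlift p (u i)) = 0 := by
    have h0 : D.form p (D.hlift p (u 0)) = 0 := D.modelForm_hlift p (u 0)
    change ⁅D.form p (D.hlift p (u 0)), D.form p (D.hlift p (u 1))⁆ = 0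
    rw [h0, zero_lie]
  refine Eq.trans (b := (lieModel EG G).symm (D.liftedCurvature p u) + bracketForm (D.form p)
    (fun i => D.hlift p (u i))) rfl ?_
  rw [h, add_zero]
  rfl

theorem curvature_apply (D : B.Connection 𝓗) {x : X₀} (u : Fin 2 → E₀) (p : B.Fiber x) :
    (D.curvature x u p : EG) = D.liftedCurvature p.1 u := by
  rw [← maurerCartan_hlift]
  refine congrArg (D.maurerCartan p.1) (funext fun i => ?_)
  exact D.lift_apply p (u i)

/-- Right translation by `g` pulls `ω` back to `Ad_{g⁻¹} ∘ ω` and permutes the horizontal lifts of a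
given vector. -/
theorem liftedCurvature_act [FiniteDimensional ℝ E₀] (D : B.Connection 𝓗) (p : P) (g : G)
    (u : Fin 2 → E₀) :
    D.liftedCurvature (B.act p g) u = lieAd EG g⁻¹ (D.liftedCurvature p u) := by
  have h := extDerivOneForm_pullback isOpen_univ
    ((B.contMDiff_act_right g).of_le two_le_infty).contMDiffOn (mem_univ p)
    D.modelForm D.modelForm (lieAd EG g⁻¹)
    (fun q _ w => D.modelForm_comp _ id (fun v => (D.hlift_act q g v).symm)
      (B.mderiv_act_vert q g) w)
    (D.diffFormAt_modelForm _) (D.diffFormAt_modelForm _) (fun i => D.hlift p (u i))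
  simp only [← hlift_act] at h
  exact h

/-- The only place where integrability is used: the action of the single arrow `γ` extends to a
local map of `P` that preserves `ω` on an open set. -/
theorem liftedCurvature_move [FiniteDimensional ℝ E₀] (hint : 𝓗.IsIntegrable)
    (D : B.Connection 𝓗) {γ : X₁} {p : P} (hp : 𝕏.s γ = B.π p) (u : Fin 2 → E₀) :
    D.liftedCurvature (B.μ γ p) (fun i => mderiv E₁ E₀ 𝕏.t γ (𝓗.slift γ (u i))) =
      D.liftedCurvature p u := by
  obtain ⟨U, S, hU, hγU, hS, hSγ, hSU⟩ := hint.exists_section γ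
  have hV : IsOpen (B.π ⁻¹' U) := hU.preimage B.smooth_π.continuous
  have hpV : p ∈ B.π ⁻¹' U := by rw [mem_preimage, ← hp]; exact hγU
  have hSπ : ContMDiffOn 𝓘(ℝ, EP) 𝓘(ℝ, E₁) 2 (S ∘ B.π) (B.π ⁻¹' U) :=
    hS.comp (B.smooth_π.of_le two_le_infty).contMDiffOn fun q hq => hq
  have hΦ : ContMDiffOn 𝓘(ℝ, EP) 𝓘(ℝ, EP) 2 (fun q => B.μ (S (B.π q)) q) (B.π ⁻¹' U) :=
    (B.smooth_μ.of_le two_le_infty).comp (hSπ.prodMk contMDiffOn_id) fun q hq => (hSU _ hq).1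
  -- Since the tangent vectors of `S` are horizontal, the differential at every `q` is `θ̃` for the
  -- arrow `S(π q)`, not only at `p`.
  have hdΦ : ∀ q ∈ B.π ⁻¹' U, ∀ w, mderiv EP EP (fun q => B.μ (S (B.π q)) q) q w =
      B.moveDeriv (S (B.π q)) q (𝓗.slift (S (B.π q)) (mderiv EP E₀ B.π q w), w) := by
    intro q hq w
    have h1 := B.mderiv_move (a := S ∘ B.π) (b := id) (x := q)
      ((hSπ.contMDiffAt (hV.mem_nhds hq)).mdifferentiableAt (by simp)) mdifferentiableAt_id
      (by filter_upwards [hV.mem_nhds hq] with z hz using (hSU _ hz).1) w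
    rw [mderiv_id, mderiv_comp ((hS.contMDiffAt (hU.mem_nhds hq)).mdifferentiableAt (by simp))
      (B.smooth_π.mdifferentiable (by simp) q), ContinuousLinearMap.comp_apply,
      (hSU _ hq).2] at h1
    exact h1
  have hdΦh : ∀ q ∈ B.π ⁻¹' U, ∀ v,
      mderiv EP EP (fun q => B.μ (S (B.π q)) q) q (D.hlift q v) =
        D.hlift (B.μ (S (B.π q)) q)
          (mderiv E₁ E₀ 𝕏.t (S (B.π q)) (𝓗.slift (S (B.π q)) v)) := fun q hq v => by
    rw [hdΦ q hq, mderiv_π_hlift, D.hlift_move (hSU _ hq).1]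
  have h := extDerivOneForm_pullback hV hΦ hpV D.modelForm D.modelForm LinearMap.id
    (fun q hq w => D.modelForm_comp _ _ (hdΦh q hq) (fun A => by
      rw [hdΦ q hq, mderiv_π_vert, map_zero, B.moveDeriv_vert (hSU _ hq).1, LinearMap.id_apply]) w)
    (D.diffFormAt_modelForm _) (D.diffFormAt_modelForm _) (fun i => D.hlift p (u i))
  simp only [hdΦh p hpV] at h
  rw [← hp, hSγ] at h
  exact h

end Connection

end

end GroupoidBundle

end

/-! ### The curvature is a differential form on the groupoid -/

theorem mainTheorem3
    {E₀ E₁ EP EG : Type*}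
    [NormedAddCommGroup E₀] [NormedSpace ℝ E₀] [FiniteDimensional ℝ E₀]
    [NormedAddCommGroup E₁] [NormedSpace ℝ E₁] [FiniteDimensional ℝ E₁]
    [NormedAddCommGroup EP] [NormedSpace ℝ EP] [FiniteDimensional ℝ EP]
    [NormedAddCommGroup EG] [NormedSpace ℝ EG] [FiniteDimensional ℝ EG]
    {X₀ X₁ P G : Type*}
    [TopologicalSpace X₀] [ChartedSpace E₀ X₀] [IsManifold 𝓘(ℝ, E₀) ∞ X₀]
    [TopologicalSpace X₁] [ChartedSpace E₁ X₁] [IsManifold 𝓘(ℝ, E₁) ∞ X₁]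
    [TopologicalSpace P] [ChartedSpace EP P] [IsManifold 𝓘(ℝ, EP) ∞ P]
    [TopologicalSpace G] [ChartedSpace EG G] [Group G] [LieGroup 𝓘(ℝ, EG) ∞ G]
    (𝕏 : LieGroupoid E₀ E₁ X₀ X₁) (𝓗 : 𝕏.Connection) (hint : 𝓗.IsIntegrable)
    (B : GroupoidBundle 𝕏 EP EG P G) (D : B.Connection 𝓗) :
    B.IsAdForm 𝓗 D.curvature ∧
    ∀ K : ∀ x : X₀, Tan E₀ x [⋀^Fin 2]→ₗ[ℝ] GroupLieAlgebra 𝓘(ℝ, EG) G,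
      (∀ p : P, pullbackForm EP E₀ (W := fun _ => GroupLieAlgebra 𝓘(ℝ, EG) G) B.π K p =
        D.maurerCartan p) → 𝓗.IsForm K := by
  -- A projected vector is the horizontal lift of its own image under `ds`, so its image under `dt`
  -- is `θ_γ` of that image.
  have hhor : ∀ (γ : X₁) (v : Fin 2 → E₁) (i : Fin 2),
      mderiv E₁ E₀ 𝕏.t γ (𝓗.slift γ (mderiv E₁ E₀ 𝕏.s γ (𝓗.proj γ (v i)))) =
        mderiv E₁ E₀ 𝕏.t γ (𝓗.proj γ (v i)) := fun γ v i => by rw [𝓗.slift_proj]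
  have hmove : ∀ (γ : X₁) (v : Fin 2 → E₁) (p : P), 𝕏.s γ = B.π p →
      D.liftedCurvature (B.μ γ p) (fun i => mderiv E₁ E₀ 𝕏.t γ (𝓗.proj γ (v i))) =
        D.liftedCurvature p fun i => mderiv E₁ E₀ 𝕏.s γ (𝓗.proj γ (v i)) := fun γ v p hp => by
    rw [← D.liftedCurvature_move hint hp]
    simp only [hhor]
  refine ⟨⟨fun x v p g => ?_, fun γ v p => ?_⟩, fun K hK γ => ?_⟩
  · refine (D.curvature_apply v (B.fiberAct p g)).trans ?_
    refine (D.liftedCurvature_act p.1 g v).trans ?_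
    exact congrArg (lieAd EG g⁻¹) (D.curvature_apply v p).symm
  · have h1 : D.curvature (𝕏.t γ) (fun i => mderiv E₁ E₀ 𝕏.t γ (𝓗.proj γ (v i)))
        (B.fiberMove γ p) =
        D.curvature (𝕏.s γ) (fun i => mderiv E₁ E₀ 𝕏.s γ (𝓗.proj γ (v i))) p :=
      (D.curvature_apply _ (B.fiberMove γ p)).trans
        ((hmove γ v p.1 p.2.symm).trans (D.curvature_apply _ p).symm)
    exact (congrArg (B.infAct (B.fiberMove γ p).1) h1).trans
      (B.thetaTilde_infAct 𝓗 γ p _).symm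
  -- Evaluating `π^*K` on horizontal lifts recovers `K`. As its values have no dependence on the
  -- point of the fibre, one point `p` over `s γ` and its image `γ · p` suffice to compare the two
  -- pullbacks.
  · have hKval : ∀ (x : X₀) (p : B.Fiber x) (u : Fin 2 → E₀),
        (K x u : EG) = D.liftedCurvature p.1 u := by
      rintro x ⟨p, rfl⟩ u
      have h1 := DFunLike.congr_fun (hK p) (fun i => D.hlift p (u i))
      refine Eq.trans ?_ (h1.trans (D.maurerCartan_hlift p u))
      exact congrArg (K (B.π p)) (funext fun i => (D.mderiv_π_hlift p (u i)).symm)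
    obtain ⟨p, hp⟩ := B.exists_mem_fiber (𝕏.s γ)
    ext v
    refine Eq.trans (hKval (𝕏.s γ) ⟨p, hp⟩ _) ((hmove γ v p hp.symm).symm.trans ?_)
    exact (hKval (𝕏.t γ) (B.fiberMove γ ⟨p, hp⟩) _).symm
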